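/- **Setting.** Let $\mathbb T=[0,\infty)$, $\mathbf T^3=\mathbf R^3/(2\pi\mathbf Z)^3$, $K\in\mathbf N$, $\alpha\in(\frac13,\frac12]$ and $p=1/\alpha$. Let $\sigma_1,\dots,\sigma_K:\mathbf T^3\to\mathbf R^3$ be divergence-free and twice differentiable, bounded together with their derivatives up to order two. Write $\mathbf W^{\beta,2}=(I-\Delta)^{-\beta/2}L^2(\mathbf T^3;\mathbf R^3)$ with norm $|\cdot|_\beta$, let $P$ be the Helmholtz–Leray projection, $\mathbf H^\beta=P\mathbf W^{\beta,2}$ (divergence-free fields) and $\mathbf H^{-\beta}$ the dual of $\mathbf H^{\beta}$ ($\beta>0$). Let $B_P(u)(\phi)=\int_{\mathbf T^3}((u\cdot\nabla)u)\cdot P\phi\,dx$ and $\mathbf D=\{[x,e]\in\mathbf H^0\times[0,\infty):\frac12|x|_0^2\le e\}$. Put $\Delta_J=\{(s,t)\in J^2:s\le t\}$. An $\alpha$-Hölder rough path is a pair $\mathbf Z=(Z,\mathbb Z)$ of two-index maps on $\Delta_{\mathbb T}$ with values in $\mathbf R^K$ and $\mathbf R^{K\times K}$ such that, on each bounded interval,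 $Z$ (resp. $\mathbb Z$) lies in the closure of the smooth two-index maps with finite $\alpha$- (resp. $2\alpha$-) Hölder coefficient $\sup_{s<t}|g_{st}|/(t-s)^{\alpha}$ (resp. $2\alpha$), with respect to that coefficient, and $$Z_{st}=Z_{s\theta}+Z_{\theta t},\qquad \mathbb Z_{st}-\mathbb Z_{s\theta}-\mathbb Z_{\theta t}=Z_{s\theta}\otimes Z_{\theta t}\qquad(0\le s\le\theta\le t).$$ Set $A^{P,1}_{st}\varphi=P[(\sigma_k\cdot\nabla)\varphi]Z^k_{st}$ and $A^{P,2}_{st}\varphi=P[(\sigma_k\cdot\nabla)P[(\sigma_i\cdot\nabla)\varphi]]\mathbb Z^{i,k}_{st}$ (summed over repeated indices), with adjoints $A^{P,1,*}_{st},A^{P,2,*}_{st}$ in $\mathbf H^0$. A control on $\Delta_J$ is a continuous map $\omega:\Delta_J\to[0,\infty)$ with $\omega(s,s)=0$ and $\omega(s,\theta)+\omega(\theta,t)\le\omega(s,t)$ for $s\le\theta\le t$. **Solutions.** For $[u_0,E_0]\in\mathbf D$, a pair $[u,E]$ is a weak solution with datum $[u_0,E_0]$ driven by $\mathbf Z$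 if 1. $u:\mathbb T\to\mathbf H^0$ is weakly continuous, $u(0)=u_0$, and $u\in L^2_{\rm loc}(\mathbb T;\mathbf H^1)\cap L^\infty_{\rm loc}(\mathbb T;\mathbf H^0)$; 2. $E:\mathbb T\to[0,\infty)$ and $E(t)=\frac12|u_t|_0^2$ for a.e. $t$; 3. $E$ is non-increasing, $E(0-)=E(0)=E_0$, and for all $0\le\tau_1\le\tau_2$ and all $0\le\psi\in C^1_c(\mathbb T)$, $$E(\tau_2+)\psi(\tau_2)-E(\tau_1-)\psi(\tau_1)-\int_{\tau_1}^{\tau_2}E\,\partial_t\psi\,dt+\int_{\tau_1}^{\tau_2}\psi\int_{\mathbf T^3}|\nabla u_t|^2\,dx\,dt\le0;$$ 4. the remainder, defined for $\phi\in\mathbf H^3$ and $0\le s\le t$ by $$u^{P,\natural}_{st}(\phi)=(u_t-u_s,\phi)+\int_s^t\big[(\nabla u_r,\nabla\phi)+B_P(u_r)(\phi)\big]dr-\big(u_s,[A^{P,1,*}_{st}+A^{P,2,*}_{st}]\phi\big),$$ is a continuous map $\Delta_{\mathbb T}\to\mathbf H^{-3}$, and there are a control $\varpi$ on $\Delta_{\mathbb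 T}$ and $L>0$ such that for every $\tau>0$ there is a control $\omega$ on $\Delta_{[0,\tau]}$ with $|u^{P,\natural}_{st}|_{-3}\le\omega(s,t)^{3/p}$ for all $0\le s\le t\le\tau$ with $\varpi(s,t)\le L$. Let $\mathcal U[u_0,E_0,\mathbf Z]$ be the set of all weak solutions with this datum and this driver, where the energy is regarded as an element of $L^1_{\rm loc}(\mathbb T;\mathbf R)$: it is identified with any function equal to it almost everywhere, conditions 2 and 3 are required of one representative, and $E(T-)$ is the left limit of that representative. **Lemma (Continuation property).** Let $[u_0,E_0]\in\mathbf D$, let $\mathbf Z$ be an $\alpha$-Hölder rough path, let $T>0$ and let $\tilde{\mathbf Z}_{st}=\mathbf Z_{T+s,T+t}$. Suppose that $$[u,E]\in\mathcal U[u_0,E_0,\mathbf Z],\qquad[\tilde u,\tilde E]\in\mathcal U[u(T),\mathcal E,\tilde{\mathbf Z}]\quad\text{for some }\mathcal E\le E(T-).$$ Then $[u,E]\cup_T[\tilde u,\tilde E]\in\mathcal U[u_0,E_0,\mathbf Z]$, where $(w_1\cup_Tw_2)(\tau)=w_1(\tau)$ for $0\le\tau\le T$ and $(w_1\cup_Tw_2)(\tau)=w_2(\tau-T)$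 for $\tau>T$. -/

import Mathlib

open MeasureTheory Filter Topology Set
open scoped ENNReal

noncomputable section

namespace RoughNS

/-! ## The torus, square integrable vector fields, Fourier coefficients -/

instance factTwoPiPos : Fact (0 < 2 * Real.pi) := ⟨Real.two_pi_pos⟩

/-- Three dimensional Euclidean space. -/
abbrev E3 := EuclideanSpace ℝ (Fin 3)

/-- The flat torus `ℝ³ / (2πℤ)³`, with its Lebesgue measure `volume` of total mass `(2π)³`. -/
abbrev T3 := Fin 3 → AddCircle (2 * Real.pi)

/-- The real Hilbert space `L²(T³; ℝ³)`. -/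
abbrev L2 : Type := Lp E3 2 (volume : Measure T3)

/-- The quotient map from `ℝ³` to the torus. -/
def proj (x : E3) : T3 := fun i => ((x i : ℝ) : AddCircle (2 * Real.pi))

/-- The character `x ↦ exp (i n·x)` of the torus. -/
def char (n : Fin 3 → ℤ) (x : T3) : ℂ := ∏ i, fourier (n i) (x i)

/-- The `j`-th component of the `n`-th Fourier coefficient,
`(2π)⁻³ ∫ exp (-i n·x) f_j(x) dx`. -/
def fc (f : L2) (n : Fin 3 → ℤ) (j : Fin 3) : ℂ :=
  ((2 * Real.pi : ℂ) ^ 3)⁻¹ * ∫ x, starRingEnd ℂ (char n x) * ((f x j : ℝ) : ℂ)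

theorem continuous_char (n : Fin 3 → ℤ) : Continuous (char n) := by
  unfold char
  fun_prop

theorem norm_char (n : Fin 3 → ℤ) (x : T3) : ‖char n x‖ = 1 := by
  rw [char, norm_prod]
  exact Finset.prod_eq_one fun i _ => by rw [fourier_apply]; exact Circle.norm_coe _

theorem integrable_comp (f : L2) (j : Fin 3) : Integrable (fun x => f x j) (volume : Measure T3) := by
  have h : Integrable (fun x => f x) (volume : Measure T3) := (Lp.memLp f).integrable one_le_two
  exact (EuclideanSpace.proj (𝕜 := ℝ) j : E3 →L[ℝ] ℝ).integrable_comp h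

theorem integrable_char_mul (f : L2) (n : Fin 3 → ℤ) (j : Fin 3) :
    Integrable (fun x => starRingEnd ℂ (char n x) * ((f x j : ℝ) : ℂ)) (volume : Measure T3) := by
  refine Integrable.bdd_mul (c := 1) (integrable_comp f j).ofReal ?_ ?_
  · exact (Complex.continuous_conj.comp (continuous_char n)).aestronglyMeasurable
  · exact Filter.Eventually.of_forall fun x => by simp [norm_char]

theorem fc_add (f g : L2) (n : Fin 3 → ℤ) (j : Fin 3) : fc (f + g) n j = fc f n j + fc g n j := by
  unfold fc
  rw [← mul_add, ← integral_add (integrable_char_mul f n j) (integrable_char_mul g n j)]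
  refine congrArg (fun z : ℂ => ((2 * Real.pi : ℂ) ^ 3)⁻¹ * z) (integral_congr_ae ?_)
  filter_upwards [Lp.coeFn_add f g] with x hx
  rw [hx]
  simp [mul_add]

theorem fc_smul (c : ℝ) (f : L2) (n : Fin 3 → ℤ) (j : Fin 3) :
    fc (c • f) n j = (c : ℂ) * fc f n j := by
  unfold fc
  rw [mul_left_comm, ← integral_const_mul (c : ℂ)]
  refine congrArg (fun z : ℂ => ((2 * Real.pi : ℂ) ^ 3)⁻¹ * z) (integral_congr_ae ?_)
  filter_upwards [Lp.coeFn_smul (p := 2) (μ := (volume : Measure T3)) c f] with x hx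
  rw [hx]
  simp
  ring

theorem fc_zero (n : Fin 3 → ℤ) (j : Fin 3) : fc 0 n j = 0 := by
  simpa using fc_smul 0 0 n j

theorem norm_fc_le (n : Fin 3 → ℤ) (j : Fin 3) : ∃ C : ℝ, ∀ f : L2, ‖fc f n j‖ ≤ C * ‖f‖ := by
  obtain ⟨K, hK⟩ : ∃ K : ℝ≥0∞, K ≠ ⊤ ∧ ∀ f : L2,
      eLpNorm f 1 (volume : Measure T3) ≤ eLpNorm f 2 (volume : Measure T3) * K := by
    refine ⟨_, ?_, fun f => eLpNorm_le_eLpNorm_mul_rpow_measure_univ one_le_two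
      (Lp.memLp f).aestronglyMeasurable⟩
    refine ENNReal.rpow_ne_top_of_nonneg (by norm_num) (measure_ne_top _ _)
  refine ⟨‖((2 * Real.pi : ℂ) ^ 3)⁻¹‖ * K.toReal, fun f => ?_⟩
  unfold fc
  rw [norm_mul, mul_assoc]
  refine mul_le_mul_of_nonneg_left ?_ (norm_nonneg _)
  have hint : Integrable (fun x => f x) (volume : Measure T3) := (Lp.memLp f).integrable one_le_two
  calc ‖∫ x, starRingEnd ℂ (char n x) * ((f x j : ℝ) : ℂ)‖
      ≤ ∫ x, ‖f x‖ := by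
        refine norm_integral_le_of_norm_le hint.norm (Filter.Eventually.of_forall fun x => ?_)
        simpa [norm_char] using PiLp.norm_apply_le (f x) j
    _ = (eLpNorm f 1 (volume : Measure T3)).toReal := by
        rw [eLpNorm_one_eq_lintegral_enorm, integral_norm_eq_lintegral_enorm hint.1]
    _ ≤ (eLpNorm f 2 (volume : Measure T3) * K).toReal :=
        ENNReal.toReal_mono (ENNReal.mul_ne_top (Lp.eLpNorm_ne_top f) hK.1) (hK.2 f)
    _ = K.toReal * ‖f‖ := by rw [ENNReal.toReal_mul, Lp.norm_def, mul_comm]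

theorem continuous_fc (n : Fin 3 → ℤ) (j : Fin 3) : Continuous fun f : L2 => fc f n j := by
  obtain ⟨C, hC⟩ := norm_fc_le n j
  let l : L2 →ₗ[ℝ] ℂ :=
    { toFun := fun f => fc f n j
      map_add' := fun f g => fc_add f g n j
      map_smul' := fun c f => by simp [fc_smul] }
  exact (l.mkContinuous C hC).continuous

/-! ## Divergence free fields, Leray projection, Sobolev spaces -/

/-- `H⁰`: the divergence free fields in `L²`. -/
def H0 : Submodule ℝ L2 where
  carrier := {f | ∀ n : Fin 3 → ℤ, ∑ j, (n j : ℂ) * fc f n j = 0}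
  add_mem' := by
    intro f g hf hg n
    have h := congrArg₂ (· + ·) (hf n) (hg n)
    simpa [fc_add, mul_add, Finset.sum_add_distrib] using h
  zero_mem' := by
    intro n
    simp [fc_zero]
  smul_mem' := by
    intro c f hf n
    have h := congrArg ((c : ℂ) * ·) (hf n)
    simpa [fc_smul, Finset.mul_sum, mul_left_comm] using h

theorem isClosed_H0 : IsClosed (H0 : Set L2) := by
  have h : (H0 : Set L2) = ⋂ n : Fin 3 → ℤ, {f : L2 | ∑ j, (n j : ℂ) * fc f n j = 0} := by
    ext f
    simp [H0]
  rw [h]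
  refine isClosed_iInter fun n => isClosed_eq ?_ continuous_const
  exact continuous_finsetSum _ fun j _ => continuous_const.mul (continuous_fc n j)

instance completeSpace_H0 : CompleteSpace H0 := isClosed_H0.completeSpace_coe

/-- The Helmholtz-Leray projection on `L²`: the orthogonal projection onto `H⁰`. -/
def leray (f : L2) : L2 := H0.starProjection f

/-- The square of the norm of `f` in `W^{β,2}`, i.e. of the `L²` norm of `(I - Δ)^{β/2} f`,
with the value `∞` when `f` is not in `W^{β,2}`. It is used for `β ≥ 0`. -/
def sobolevSq (β : ℝ) (f : L2) : ℝ≥0∞ :=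
  ∑' n : Fin 3 → ℤ, ENNReal.ofReal
    ((2 * Real.pi) ^ 3 * (1 + ∑ i, (n i : ℝ) ^ 2) ^ β * ∑ j, ‖fc f n j‖ ^ 2)

/-- The norm `|f|_β` of `W^{β,2}`. -/
def sobolevNorm (β : ℝ) (f : L2) : ℝ := Real.sqrt (sobolevSq β f).toReal

/-- `H^β = P W^{β,2}` for `β ≥ 0`: the divergence free fields in `W^{β,2}`. -/
def Hs (β : ℝ) : Set L2 := {f | f ∈ H0 ∧ sobolevSq β f ≠ ∞}

/-- `g` is the weak partial derivative `D_i f`, tested against the exponentials. -/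
def IsWeakDeriv (i : Fin 3) (f g : L2) : Prop :=
  ∀ (n : Fin 3 → ℤ) (j : Fin 3), fc g n j = Complex.I * (n i : ℂ) * fc f n j

open Classical in
/-- The weak partial derivative `D_i f ∈ L²` (it exists for all `i` iff `f ∈ W^{1,2}`; otherwise
a value `0` is used). -/
def D (i : Fin 3) (f : L2) : L2 := if h : ∃ g, IsWeakDeriv i f g then h.choose else 0

/-- The `L²` inner product `(∇u, ∇φ)`. -/
def gradInner (u φ : L2) : ℝ := ∑ i, inner ℝ (D i u) (D i φ)

/-- The trilinear form `b(u,v,w) = ∫ ((u·∇)v)·w dx`. -/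
def trilin (u v w : L2) : ℝ :=
  ∫ x, ∑ i, ∑ j, (u x i) * (D i v x j) * (w x j)

/-- `B_P(u)(φ)`, where `B_P(u) = P B(u)` and `B(u)(φ) = b(u,u,φ)`. -/
def BP (u φ : L2) : ℝ := trilin u u (leray φ)

open Classical in
/-- The class in `L²` of a square integrable function on the torus. -/
def toL2 (F : T3 → E3) : L2 := if h : MemLp F 2 (volume : Measure T3) then h.toLp F else 0

/-- `(σ·∇)φ` for `φ ∈ W^{1,2}`. -/
def advect (σ : T3 → E3) (φ : L2) : L2 := toL2 fun x => ∑ i, (σ x i) • (D i φ x)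

/-- `σ` is twice differentiable, bounded together with its derivatives up to order two, and
divergence free. -/
structure IsNoiseField (σ : T3 → E3) : Prop where
  diff : Differentiable ℝ (σ ∘ proj)
  diff_two : Differentiable ℝ (fderiv ℝ (σ ∘ proj))
  bounded : ∃ M : ℝ, ∀ x : E3, ‖(σ ∘ proj) x‖ ≤ M ∧ ‖fderiv ℝ (σ ∘ proj) x‖ ≤ M ∧
    ‖fderiv ℝ (fderiv ℝ (σ ∘ proj)) x‖ ≤ M
  div_free : ∀ x : E3, ∑ i, (fderiv ℝ (σ ∘ proj) x (EuclideanSpace.single i 1)) i = 0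

/-! ## Rough paths -/

/-- The simplex `Δ_J` of ordered pairs of times in `J`. -/
def simplex (J : Set ℝ) : Set (ℝ × ℝ) := {q | q.1 ∈ J ∧ q.2 ∈ J ∧ q.1 ≤ q.2}

/-- The space `C_2^α([0,τ]; V)`: the closure of the smooth two-index maps with finite Hölder
coefficient, with respect to the Hölder coefficient. -/
def HolderTwo {V : Type*} [NormedAddCommGroup V] [NormedSpace ℝ V] (α τ : ℝ) (g : ℝ → ℝ → V) :
    Prop :=
  ∀ ε > 0, ∃ h : ℝ × ℝ → V, ContDiff ℝ ((⊤ : ℕ∞) : WithTop ℕ∞) h ∧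
    (∃ C : ℝ, ∀ s t, 0 ≤ s → s ≤ t → t ≤ τ → ‖h (s, t)‖ ≤ C * (t - s) ^ α) ∧
    ∀ s t, 0 ≤ s → s ≤ t → t ≤ τ → ‖g s t - h (s, t)‖ ≤ ε * (t - s) ^ α

/-- A pair of two-index maps with values in `ℝ^K` and `ℝ^{K×K}`. -/
structure TwoLevel (K : ℕ) where
  fst : ℝ → ℝ → EuclideanSpace ℝ (Fin K)
  snd : ℝ → ℝ → EuclideanSpace ℝ (Fin K × Fin K)

/-- The shifted pair `Z(T + ·)`. -/
def TwoLevel.shift {K : ℕ} (Z : TwoLevel K) (T : ℝ) : TwoLevel K where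
  fst := fun s t => Z.fst (T + s) (T + t)
  snd := fun s t => Z.snd (T + s) (T + t)

/-- `α`-Hölder rough paths on `[0,∞)`: the first level is the increment of a path and the second
one satisfies Chen's relation. -/
structure IsRoughPath {K : ℕ} (α : ℝ) (Z : TwoLevel K) : Prop where
  holder_fst : ∀ τ, 0 < τ → HolderTwo α τ Z.fst
  holder_snd : ∀ τ, 0 < τ → HolderTwo (2 * α) τ Z.snd
  additive : ∀ s θ t, 0 ≤ s → s ≤ θ → θ ≤ t → Z.fst s t - Z.fst θ t - Z.fst s θ = 0
  chen : ∀ s θ t, 0 ≤ s → s ≤ θ → θ ≤ t → ∀ i k,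
    Z.snd s t (i, k) - Z.snd θ t (i, k) - Z.snd s θ (i, k) = Z.fst s θ i * Z.fst θ t k

/-! ## Unbounded rough driver of the system -/

/-- `A^{P,1}_{st} φ = P[(σ_k·∇)φ] Z^k_{st}`. -/
def A1 {K : ℕ} (σ : Fin K → T3 → E3) (Z : TwoLevel K) (s t : ℝ) (φ : L2) : L2 :=
  ∑ k, Z.fst s t k • leray (advect (σ k) φ)

/-- `A^{P,2}_{st} φ = P[(σ_k·∇) P[(σ_i·∇)φ]] ℤ^{i,k}_{st}`. -/
def A2 {K : ℕ} (σ : Fin K → T3 → E3) (Z : TwoLevel K) (s t : ℝ) (φ : L2) : L2 :=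
  ∑ i, ∑ k, Z.snd s t (i, k) • leray (advect (σ k) (leray (advect (σ i) φ)))

open Classical in
/-- The adjoint in `H⁰` of an operator `A : H^m → H⁰`, evaluated at `φ`: the unique `g ∈ H⁰` with
`(g, ψ) = (φ, A ψ)` for all `ψ ∈ H^m`. -/
def adjointAt (m : ℝ) (A : L2 → L2) (φ : L2) : L2 :=
  if h : ∃ g ∈ H0, ∀ ψ ∈ Hs m, inner ℝ g ψ = inner ℝ φ (A ψ) then h.choose else 0

/-- `A^{P,1,*}_{st} φ`. -/
def A1star {K : ℕ} (σ : Fin K → T3 → E3) (Z : TwoLevel K) (s t : ℝ) (φ : L2) : L2 :=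
  adjointAt 1 (A1 σ Z s t) φ

/-- `A^{P,2,*}_{st} φ`. -/
def A2star {K : ℕ} (σ : Fin K → T3 → E3) (Z : TwoLevel K) (s t : ℝ) (φ : L2) : L2 :=
  adjointAt 2 (A2 σ Z s t) φ

/-! ## Controls and local variation spaces -/

/-- Controls on `Δ_J`. -/
structure IsControl (J : Set ℝ) (ω : ℝ → ℝ → ℝ) : Prop where
  nonneg : ∀ s ∈ J, ∀ t ∈ J, s ≤ t → 0 ≤ ω s t
  cont : ContinuousOn (fun q : ℝ × ℝ => ω q.1 q.2) (simplex J)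
  diag : ∀ s ∈ J, ω s s = 0
  superadd : ∀ s ∈ J, ∀ θ ∈ J, ∀ t ∈ J, s ≤ θ → θ ≤ t → ω s θ + ω θ t ≤ ω s t

/-- `|g|_{-β} ≤ C` for a functional `g` on `H^β`. -/
def DualBound (β : ℝ) (g : L2 → ℝ) (C : ℝ) : Prop :=
  ∀ φ ∈ Hs β, |g φ| ≤ C * sobolevNorm β φ

/-- `g` is an element of `H^{-β}`, the topological dual of `H^β`. -/
structure MemDual (β : ℝ) (g : L2 → ℝ) : Prop where
  add : ∀ φ ∈ Hs β, ∀ ψ ∈ Hs β, g (φ + ψ) = g φ + g ψ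
  smul : ∀ (c : ℝ), ∀ φ ∈ Hs β, g (c • φ) = c * g φ
  bounded : ∃ C : ℝ, DualBound β g C

/-- The two-index map `g` belongs to `C^{q-var}_{2,ϖ,L,loc}([0,∞); H^{-β})`. -/
structure MemVarLoc (β q : ℝ) (ϖ : ℝ → ℝ → ℝ) (L : ℝ) (g : ℝ → ℝ → L2 → ℝ) : Prop where
  mem : ∀ s t, 0 ≤ s → s ≤ t → MemDual β (g s t)
  cont : ∀ a ∈ simplex (Ici 0), ∀ ε > 0, ∀ᶠ b in 𝓝[simplex (Ici 0)] a,
    DualBound β (fun φ => g b.1 b.2 φ - g a.1 a.2 φ) ε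
  var : ∀ τ, 0 < τ → ∃ ω, IsControl (Icc 0 τ) ω ∧ ∀ s t, 0 ≤ s → s ≤ t → t ≤ τ → ϖ s t ≤ L →
    DualBound β (g s t) (ω s t ^ (1 / q))

/-! ## Weak solutions -/

/-- The remainder `u^{P,♮}_{st}(φ)`. -/
def remainder {K : ℕ} (σ : Fin K → T3 → E3) (Z : TwoLevel K) (u : ℝ → L2) (s t : ℝ) (φ : L2) : ℝ :=
  inner ℝ (u t - u s) φ + (∫ r in s..t, (gradInner (u r) φ + BP (u r) φ))
    - inner ℝ (u s) (A1star σ Z s t φ + A2star σ Z s t φ)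

/-- `E(t-)`, with the convention `E(0-) = E(0)`. -/
def lim_left (E : ℝ → ℝ) (t : ℝ) : ℝ := Function.leftLim (fun r => E (max r 0)) t

/-- `E(t+)`. -/
def lim_right (E : ℝ → ℝ) (t : ℝ) : ℝ := Function.rightLim (fun r => E (max r 0)) t

/-- `[u,E]` is a weak solution of the Navier-Stokes system with datum `[u₀,E₀] ∈ 𝐃`, driven by
`Z`; only the values at times `t ≥ 0` matter. Here `p = 1/α`. -/
structure IsWeakSolution {K : ℕ} (σ : Fin K → T3 → E3) (α : ℝ) (Z : TwoLevel K) (u₀ : L2) (E₀ : ℝ)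
    (u : ℝ → L2) (E : ℝ → ℝ) : Prop where
  data_mem : u₀ ∈ H0
  data_le : (1 / 2) * ‖u₀‖ ^ 2 ≤ E₀
  u_mem : ∀ t, 0 ≤ t → u t ∈ H0
  u_weak_cont : ∀ h : L2, ContinuousOn (fun t => (inner ℝ (u t) h : ℝ)) (Ici 0)
  u_L2H1 : ∀ τ, 0 < τ → ∫⁻ t in Icc 0 τ, sobolevSq 1 (u t) < ∞
  u_bounded : ∀ τ, 0 < τ → ∃ C : ℝ, ∀ᵐ t ∂(volume.restrict (Icc 0 τ)), ‖u t‖ ≤ C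
  u_init : u 0 = u₀
  E_nonneg : ∀ t, 0 ≤ t → 0 ≤ E t
  E_eq : ∀ᵐ t ∂(volume.restrict (Ici 0)), E t = (1 / 2) * ‖u t‖ ^ 2
  E_init : E 0 = E₀
  E_antitone : AntitoneOn E (Ici 0)
  energy : ∀ τ₁ τ₂, 0 ≤ τ₁ → τ₁ ≤ τ₂ → ∀ ψ : ℝ → ℝ, ContDiff ℝ 1 ψ → HasCompactSupport ψ →
    (∀ t, 0 ≤ t → 0 ≤ ψ t) →
    (lim_right E τ₂ * ψ τ₂ - lim_left E τ₁ * ψ τ₁) - (∫ t in τ₁..τ₂, E t * deriv ψ t)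
      + (∫ t in τ₁..τ₂, ψ t * gradInner (u t) (u t)) ≤ 0
  remainder_mem : ∃ (ϖ : ℝ → ℝ → ℝ) (L : ℝ), IsControl (Ici 0) ϖ ∧ 0 < L ∧
    MemVarLoc 3 ((1 / α) / 3) ϖ L (remainder σ Z u)

/-- The solution set `𝓤[u₀,E₀,Z]`. The energy is an element of `L¹_loc([0,∞); ℝ)`, so that it is
given up to equality almost everywhere and it has to have one representative as required. The
velocity is determined at all times `t ≥ 0`. -/
def solutionSet {K : ℕ} (σ : Fin K → T3 → E3) (α : ℝ) (Z : TwoLevel K) (u₀ : L2) (E₀ : ℝ) :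
    Set ((ℝ → L2) × (ℝ → ℝ)) :=
  {w | ∃ E' : ℝ → ℝ, E' =ᵐ[volume.restrict (Ici 0)] w.2 ∧ IsWeakSolution σ α Z u₀ E₀ w.1 E'}

/-- `l = E(T-)` for an energy `E` that is given up to equality almost everywhere (for `T > 0`):
the left limit at `T` of any monotone representative. -/
def IsEssLeftLim (E : ℝ → ℝ) (T l : ℝ) : Prop := Tendsto E (𝓝[<] T ⊓ ae volume) (𝓝 l)

/-- The concatenation `w₁ ∪_T w₂`. -/
def concat {X : Type*} (T : ℝ) (w₁ w₂ : ℝ → X) (τ : ℝ) : X :=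
  if τ ≤ T then w₁ τ else w₂ (τ - T)

end RoughNS

end

/-! All conditions on a weak solution except two are local in time and pass to the glued pair
because the velocities agree at `T`. The exceptions are the energy inequality and the remainder
estimate on intervals that straddle `T`.

Energy. The representative `concatEnergy` takes the value of the second energy at `T`, so its left
limit there is that of the first energy and its right limit that of the second. The first inequality
on `[τ₁, T]` holds with the left limit at the upper endpoint (`EnergyInequality.left`); the second
one starts from a value that is at most this limit. Adding the two leaves a downward jump times `ψ T
≥ 0`, which has the right sign (`EnergyInequality.concat`).

Remainder. For `s ≤ T ≤ t` the driver terms at time `T` cancel in `R s t = R₁ s t - R₁ T t + R₂ 0 (t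
- T)` (`remainder_concat_mid`). Hence `R` is continuous in the dual norm and vanishes at `(T, T)`.
No rate is needed across `T`: a partition has at most one interval with `T` in its interior, so any
such continuous function is bounded by a prescribed power of a control
(`exists_control_of_continuousOn`). Away from `T` the two given controls serve, in truncated time
(`MemVarLoc.concat`).

Cutting time integrals at `T` requires genuine integrability of drift and dissipation. This is the
purpose of the Fourier analysis: Parseval's identity, the embedding of `H³` into `L^∞`, and Borel
measurability of the weak derivative on `L²`. -/

noncomputable section

namespace RoughNS

/-! ## Fourier series on the torus -/

/-- The characters as continuous maps. -/
def charC (n : Fin 3 → ℤ) : C(T3, ℂ) := ⟨char n, continuous_char n⟩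

theorem charC_add (m n : Fin 3 → ℤ) : charC (m + n) = charC m * charC n := by
  ext x
  simp [charC, char, Finset.prod_mul_distrib]

theorem charC_neg (n : Fin 3 → ℤ) : charC (-n) = star (charC n) := by
  ext x
  simp [charC, char]

theorem charC_zero : charC 0 = 1 := by
  ext x
  simp [charC, char]

theorem conj_char (n : Fin 3 → ℤ) (x : T3) : starRingEnd ℂ (char n x) = char (-n) x := by
  simp [char]

/-- The star subalgebra of trigonometric polynomials. -/
def trigSubalgebra : StarSubalgebra ℂ C(T3, ℂ) where
  toSubalgebra := Algebra.adjoin ℂ (range charC)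
  star_mem' := by
    change Algebra.adjoin ℂ (range charC) ≤ star (Algebra.adjoin ℂ (range charC))
    refine Algebra.adjoin_le ?_
    rintro _ ⟨n, rfl⟩
    exact Algebra.subset_adjoin ⟨-n, charC_neg n⟩

/-- Products of characters are characters, so their linear span is already an algebra. -/
theorem trigSubalgebra_coe :
    Subalgebra.toSubmodule trigSubalgebra.toSubalgebra = Submodule.span ℂ (range charC) := by
  apply Algebra.adjoin_eq_span_of_subset
  refine .trans (fun x ↦ Submonoid.closure_induction (fun _ ↦ id) ⟨0, charC_zero⟩ ?_)
    Submodule.subset_span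
  rintro _ _ _ _ ⟨m, rfl⟩ ⟨n, rfl⟩
  exact ⟨m + n, charC_add m n⟩

theorem trigSubalgebra_separatesPoints : trigSubalgebra.SeparatesPoints := by
  classical
  intro x y hxy
  obtain ⟨i, hi⟩ := Function.ne_iff.mp hxy
  refine ⟨_, ⟨charC (Pi.single i 1), Algebra.subset_adjoin ⟨Pi.single i 1, rfl⟩, rfl⟩, ?_⟩
  have key : ∀ z : T3, charC (Pi.single i 1) z = fourier 1 (z i) := by
    intro z
    change ∏ j, fourier ((Pi.single i 1 : Fin 3 → ℤ) j) (z j) = _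
    rw [Finset.prod_eq_single i]
    · simp
    · intro j _ hj
      simp [Pi.single_eq_of_ne hj]
    · simp
  change charC (Pi.single i 1) x ≠ charC (Pi.single i 1) y
  rw [key, key, fourier_one, fourier_one]
  contrapose hi
  exact AddCircle.injective_toCircle Real.two_pi_pos.ne' (Circle.ext hi)

/-- Stone–Weierstrass; the characters of the single coordinates already separate points. -/
theorem span_charC_closure_eq_top : (Submodule.span ℂ (range charC)).topologicalClosure = ⊤ := by
  rw [← trigSubalgebra_coe]
  exact congr_arg (Subalgebra.toSubmodule <| StarSubalgebra.toSubalgebra ·)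
    (ContinuousMap.starSubalgebra_topologicalClosure_eq_top_of_separatesPoints _
      trigSubalgebra_separatesPoints)

/-- The complex Hilbert space `L²(T³; ℂ)`. -/
abbrev L2C : Type := Lp ℂ 2 (volume : Measure T3)

/-- The characters as elements of `L²`. -/
def charL (n : Fin 3 → ℤ) : L2C := ContinuousMap.toLp (E := ℂ) 2 volume ℂ (charC n)

theorem coeFn_charL (n : Fin 3 → ℤ) : charL n =ᵐ[volume] char n :=
  ContinuousMap.coeFn_toLp volume (charC n)

theorem integral_fourier (k : ℤ) :
    ∫ x : AddCircle (2 * Real.pi), fourier k x = if k = 0 then (2 * Real.pi : ℂ) else 0 := by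
  split_ifs with h
  · subst h
    simp [measureReal_def, AddCircle.measure_univ, Real.pi_pos.le]
  · have := orthonormal_iff_ite.mp (orthonormal_fourier (T := 2 * Real.pi)) 0 k
    rw [if_neg (Ne.symm h), ContinuousMap.inner_toLp] at this
    rw [AddCircle.volume_eq_smul_haarAddCircle, integral_smul_measure]
    rw [smul_eq_zero]
    right
    simpa using this

theorem integral_char (n : Fin 3 → ℤ) :
    ∫ x, char n x = if n = 0 then (2 * Real.pi : ℂ) ^ 3 else 0 := by
  unfold char
  rw [MeasureTheory.integral_fintype_prod_volume_eq_prod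
    (fun i (y : AddCircle (2 * Real.pi)) => fourier (n i) y)]
  simp only [integral_fourier]
  split_ifs with h
  · subst h
    simp
  · obtain ⟨i, hi⟩ := Function.ne_iff.mp h
    exact Finset.prod_eq_zero (Finset.mem_univ i) (if_neg hi)

theorem inner_charL (m n : Fin 3 → ℤ) :
    inner ℂ (charL m) (charL n) = if m = n then (2 * Real.pi : ℂ) ^ 3 else 0 := by
  unfold charL
  rw [ContinuousMap.inner_toLp]
  have h : ∀ x, charC n x * starRingEnd ℂ (charC m x) = char (n + -m) x := by
    intro x
    change char n x * starRingEnd ℂ (char m x) = char (n + -m) x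
    rw [conj_char]
    exact (DFunLike.congr_fun (charC_add n (-m)) x).symm
  simp only [h, integral_char, ← sub_eq_add_neg, sub_eq_zero, @eq_comm _ n m]

/-- The normalising constant `(2π)^{-3/2}`. -/
def normConst : ℝ := (Real.sqrt ((2 * Real.pi) ^ 3))⁻¹

theorem normConst_sq : normConst ^ 2 = ((2 * Real.pi) ^ 3)⁻¹ := by
  rw [normConst, inv_pow, Real.sq_sqrt (by positivity)]

theorem orthonormal_charL : Orthonormal ℂ fun n => (normConst : ℂ) • charL n := by
  rw [orthonormal_iff_ite]
  intro m n
  rw [inner_smul_left, inner_smul_right, inner_charL, Complex.conj_ofReal, ← mul_assoc, ← sq,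
    ← Complex.ofReal_pow, normConst_sq]
  split_ifs
  · push_cast
    exact inv_mul_cancel₀ (by simp [Real.pi_ne_zero])
  · simp

/-- Uniform density passes to `L²` through the dense inclusion of continuous functions, and
rescaling by a nonzero constant does not change the span. -/
theorem span_charL_closure_eq_top :
    (Submodule.span ℂ (range fun n => (normConst : ℂ) • charL n)).topologicalClosure = ⊤ := by
  have h1 : (Submodule.span ℂ (range charL)).topologicalClosure = ⊤ := by
    have := (ContinuousMap.toLp_denseRange (p := 2) ℂ (volume : Measure T3) ℂ
      (by simp)).topologicalClosure_map_submodule span_charC_closure_eq_top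
    rw [Submodule.map_span, ← range_comp] at this
    exact this
  have hc : (normConst : ℂ) ≠ 0 := by
    have : 0 < normConst := by unfold normConst; positivity
    exact_mod_cast this.ne'
  have h2 : Submodule.span ℂ (range charL) ≤
      Submodule.span ℂ (range fun n => (normConst : ℂ) • charL n) := by
    rw [Submodule.span_le]
    rintro _ ⟨n, rfl⟩
    have := Submodule.smul_mem (Submodule.span ℂ (range fun n => (normConst : ℂ) • charL n))
      (normConst : ℂ)⁻¹ (Submodule.subset_span ⟨n, rfl⟩)
    rwa [smul_smul, inv_mul_cancel₀ hc, one_smul] at this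
  exact top_le_iff.mp (h1 ▸ Submodule.topologicalClosure_mono h2)

/-- The Hilbert basis of `L²(T³; ℂ)` given by the normalised characters. -/
def charBasis : HilbertBasis (Fin 3 → ℤ) ℂ L2C :=
  HilbertBasis.mk orthonormal_charL span_charL_closure_eq_top.ge

theorem memLp_comp (f : L2) (j : Fin 3) :
    MemLp (fun x => ((f x j : ℝ) : ℂ)) 2 (volume : Measure T3) :=
  ((Lp.memLp f).continuousLinearMap_comp (EuclideanSpace.proj (𝕜 := ℝ) j : E3 →L[ℝ] ℝ)).ofReal

/-- The `j`-th component of a vector field, as a complex valued function. -/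
def compL (f : L2) (j : Fin 3) : L2C := (memLp_comp f j).toLp _

theorem inner_charL_compL (f : L2) (n : Fin 3 → ℤ) (j : Fin 3) :
    inner ℂ (charL n) (compL f j) = (2 * Real.pi : ℂ) ^ 3 * fc f n j := by
  rw [fc, ← mul_assoc, mul_inv_cancel₀ (by simp [Real.pi_ne_zero]), one_mul,
    MeasureTheory.L2.inner_def]
  refine integral_congr_ae ?_
  filter_upwards [coeFn_charL n, (memLp_comp f j).coeFn_toLp] with x h1 h2
  rw [compL, h1, h2, RCLike.inner_apply, mul_comm]

theorem norm_sq_eq_sum_compL (f : L2) : ‖f‖ ^ 2 = ∑ j, ‖compL f j‖ ^ 2 := by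
  have hf : ‖f‖ ^ 2 = ∫ x, ‖f x‖ ^ 2 := by
    rw [← real_inner_self_eq_norm_sq, MeasureTheory.L2.inner_def]
    simp only [real_inner_self_eq_norm_sq]
  have hj : ∀ j, ‖compL f j‖ ^ 2 = ∫ x, (f x j) ^ 2 := by
    intro j
    have h : ((‖compL f j‖ ^ 2 : ℝ) : ℂ) = ((∫ x, (f x j) ^ 2 : ℝ) : ℂ) := by
      rw [← integral_complex_ofReal, Complex.ofReal_pow, ← Complex.coe_algebraMap,
        ← inner_self_eq_norm_sq_to_K (𝕜 := ℂ), MeasureTheory.L2.inner_def]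
      refine integral_congr_ae ?_
      filter_upwards [(memLp_comp f j).coeFn_toLp] with x h2
      rw [compL, h2, RCLike.inner_apply, Complex.conj_ofReal]
      rw [Complex.coe_algebraMap, Complex.ofReal_pow, sq]
    exact_mod_cast h
  have hi : ∀ j, Integrable (fun x => (f x j) ^ 2) (volume : Measure T3) := fun j =>
    ((Lp.memLp f).continuousLinearMap_comp
      (EuclideanSpace.proj (𝕜 := ℝ) j : E3 →L[ℝ] ℝ)).integrable_sq
  simp only [hj]
  rw [hf, ← integral_finsetSum _ fun j _ => hi j]
  simp [EuclideanSpace.norm_sq_eq]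

/-- Parseval's identity. -/
theorem hasSum_norm_fc_sq (f : L2) :
    HasSum (fun n => (2 * Real.pi) ^ 3 * ∑ j, ‖fc f n j‖ ^ 2) (‖f‖ ^ 2) := by
  rw [norm_sq_eq_sum_compL]
  simp only [Finset.mul_sum]
  refine hasSum_sum fun j _ => ?_
  have h := RCLike.hasSum_re ℂ (charBasis.hasSum_inner_mul_inner (compL f j) (compL f j))
  simp only [← inner_conj_symm (compL f j) (charBasis _)] at h
  rw [inner_self_eq_norm_sq] at h
  refine h.congr_fun fun n => ?_
  rw [charBasis, HilbertBasis.coe_mk, inner_smul_left, inner_charL_compL, ← Complex.normSq_eq_conj_mul_self,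
    Complex.conj_ofReal, Complex.normSq_eq_norm_sq, norm_mul, norm_mul, mul_pow, mul_pow,
    Complex.norm_real, Real.norm_eq_abs, sq_abs, normConst_sq]
  have : ‖(2 * Real.pi : ℂ) ^ 3‖ = (2 * Real.pi) ^ 3 := by
    rw [norm_pow, norm_mul]
    simp [abs_of_pos Real.pi_pos]
  rw [this]
  simp only [RCLike.re_to_complex, Complex.ofReal_re]
  field_simp

theorem eq_zero_of_fc_eq_zero {f : L2} (h : ∀ n j, fc f n j = 0) : f = 0 := by
  have h1 := hasSum_norm_fc_sq f
  simp only [h] at h1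
  have : ‖f‖ ^ 2 = 0 := h1.unique (by simp)
  simpa using this

theorem fc_sub (f g : L2) (n : Fin 3 → ℤ) (j : Fin 3) : fc (f - g) n j = fc f n j - fc g n j := by
  rw [sub_eq_add_neg, fc_add, ← neg_one_smul ℝ g, fc_smul]
  simp [sub_eq_add_neg]

theorem fc_injective {f g : L2} (h : ∀ n j, fc f n j = fc g n j) : f = g :=
  sub_eq_zero.mp (eq_zero_of_fc_eq_zero fun n j => by rw [fc_sub, h, sub_self])

theorem norm_sq_eq_tsum (f : L2) :
    ENNReal.ofReal (‖f‖ ^ 2) = ∑' n, ENNReal.ofReal ((2 * Real.pi) ^ 3 * ∑ j, ‖fc f n j‖ ^ 2) := by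
  rw [← (hasSum_norm_fc_sq f).tsum_eq,
    ENNReal.ofReal_tsum_of_nonneg (fun n => by positivity) (hasSum_norm_fc_sq f).summable]

theorem norm_sq_le_sobolevSq (f : L2) : ENNReal.ofReal (‖f‖ ^ 2) ≤ sobolevSq 1 f := by
  rw [norm_sq_eq_tsum]
  refine ENNReal.tsum_le_tsum fun n => ENNReal.ofReal_le_ofReal ?_
  rw [Real.rpow_one]
  have h1 : 0 ≤ ∑ i, (n i : ℝ) ^ 2 := by positivity
  have h2 : 0 ≤ ∑ j, ‖fc f n j‖ ^ 2 := by positivity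
  gcongr
  nlinarith [Real.pi_pos, pow_pos Real.two_pi_pos 3]

theorem norm_D_sq_le_sobolevSq (i : Fin 3) (f : L2) :
    ENNReal.ofReal (‖D i f‖ ^ 2) ≤ sobolevSq 1 f := by
  by_cases h : ∃ g, IsWeakDeriv i f g
  · have hD : D i f = h.choose := dif_pos h
    have hs : IsWeakDeriv i f (D i f) := hD ▸ h.choose_spec
    rw [norm_sq_eq_tsum]
    refine ENNReal.tsum_le_tsum fun n => ENNReal.ofReal_le_ofReal ?_
    simp only [hs n, norm_mul, Complex.norm_I, Complex.norm_intCast, one_mul, mul_pow, sq_abs,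
      ← Finset.mul_sum, Real.rpow_one, mul_assoc]
    gcongr
    have := Finset.single_le_sum (f := fun i => (n i : ℝ) ^ 2) (fun _ _ => sq_nonneg _)
      (Finset.mem_univ i)
    linarith
  -- Without a weak derivative `D i f` is the default `0`, so the bound holds for every `f`.
  · simp [D, dif_neg h]

/-! ## Sobolev embedding -/

/-- The weight dominates the product of the factors `1 + n_i²`, whose inverses form a product of
three convergent one-dimensional series. -/
theorem summable_weight : Summable fun n : Fin 3 → ℤ => ((1 + ∑ i, (n i : ℝ) ^ 2) ^ (3 : ℝ))⁻¹ := by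
  have h1 : Summable fun k : ℤ => (1 + (k : ℝ) ^ 2)⁻¹ := by
    have h0 : Summable fun k : ℤ => ((k : ℝ) ^ 2)⁻¹ := by
      simpa using Real.summable_one_div_int_pow.mpr (by norm_num : 1 < 2)
    refine Summable.of_norm_bounded_eventually h0 ?_
    refine (Set.finite_singleton (0 : ℤ)).subset ?_
    intro k hk
    by_contra hk0
    refine hk ?_
    have : (0 : ℝ) < (k : ℝ) ^ 2 := by
      have : (k : ℝ) ≠ 0 := by exact_mod_cast hk0
      positivity
    change ‖(1 + (k : ℝ) ^ 2)⁻¹‖ ≤ ((k : ℝ) ^ 2)⁻¹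
    rw [Real.norm_eq_abs, abs_of_pos (by positivity)]
    gcongr
    linarith
  have h2 : Summable fun n : Fin 3 → ℤ => ∏ i, (1 + (n i : ℝ) ^ 2)⁻¹ := by
    have h3 := h1.mul_of_nonneg (h1.mul_of_nonneg h1 (fun _ => by positivity)
      (fun _ => by positivity)) (fun _ => by positivity) (fun _ => by positivity)
    have hinj : Function.Injective fun n : Fin 3 → ℤ => (n 0, n 1, n 2) := by
      intro m n h
      simp only [Prod.mk.injEq] at h
      ext i
      fin_cases i
      exacts [h.1, h.2.1, h.2.2]
    refine (h3.comp_injective hinj).congr fun n => ?_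
    simp only [Function.comp_apply, Fin.prod_univ_three, mul_assoc]
  refine Summable.of_nonneg_of_le (fun n => by positivity) (fun n => ?_) h2
  rw [Finset.prod_inv_distrib]
  have h3 : ∀ i, (n i : ℝ) ^ 2 ≤ ∑ i, (n i : ℝ) ^ 2 := fun i =>
    Finset.single_le_sum (f := fun i => (n i : ℝ) ^ 2) (fun _ _ => sq_nonneg _) (Finset.mem_univ i)
  have h4 : ∏ i, (1 + (n i : ℝ) ^ 2) ≤ (1 + ∑ i, (n i : ℝ) ^ 2) ^ (3 : ℝ) := by
    have := Finset.prod_le_prod (s := Finset.univ) (f := fun i => 1 + (n i : ℝ) ^ 2)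
      (g := fun _ => 1 + ∑ i, (n i : ℝ) ^ 2) (fun i _ => by positivity)
      fun i _ => by linarith [h3 i]
    rw [Finset.prod_const] at this
    exact_mod_cast this
  gcongr

theorem summable_norm_fc {φ : L2} (hφ : sobolevSq 3 φ ≠ ∞) (j : Fin 3) :
    Summable fun n => ‖fc φ n j‖ := by
  have h1 : Summable fun n : Fin 3 → ℤ =>
      (2 * Real.pi) ^ 3 * (1 + ∑ i, (n i : ℝ) ^ 2) ^ (3 : ℝ) * ∑ j, ‖fc φ n j‖ ^ 2 := by
    have := ENNReal.summable_toReal hφ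
    refine this.congr fun n => ?_
    rw [ENNReal.toReal_ofReal (by positivity)]
  refine Summable.of_nonneg_of_le (fun n => norm_nonneg _) (fun n => ?_) (h1.add summable_weight)
  set w : ℝ := (1 + ∑ i, (n i : ℝ) ^ 2) ^ (3 : ℝ) with hw
  have hw0 : 0 < w := by positivity
  have h2 : ‖fc φ n j‖ ^ 2 ≤ ∑ j, ‖fc φ n j‖ ^ 2 :=
    Finset.single_le_sum (f := fun j => ‖fc φ n j‖ ^ 2) (fun _ _ => sq_nonneg _) (Finset.mem_univ j)
  have h3 : 1 ≤ (2 * Real.pi) ^ 3 := one_le_pow₀ (by linarith [Real.pi_gt_three])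
  -- Young's inequality splits the coefficient into a term of the `H³` norm and a summable weight.
  have h4 : ‖fc φ n j‖ ≤ w * ‖fc φ n j‖ ^ 2 + w⁻¹ := by
    have : 0 ≤ w * (‖fc φ n j‖ - w⁻¹) ^ 2 := by positivity
    have h5 : w * (‖fc φ n j‖ - w⁻¹) ^ 2 = w * ‖fc φ n j‖ ^ 2 - 2 * ‖fc φ n j‖ + w⁻¹ := by
      field_simp
      ring
    linarith [norm_nonneg (fc φ n j)]
  have h6 : w * ‖fc φ n j‖ ^ 2 ≤ (2 * Real.pi) ^ 3 * w * ∑ j, ‖fc φ n j‖ ^ 2 := by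
    rw [mul_assoc]
    calc w * ‖fc φ n j‖ ^ 2 ≤ w * ∑ j, ‖fc φ n j‖ ^ 2 := by gcongr
      _ ≤ (2 * Real.pi) ^ 3 * (w * ∑ j, ‖fc φ n j‖ ^ 2) :=
        le_mul_of_one_le_left (by positivity) h3
  linarith

/-- Sobolev embedding: the Fourier coefficients are absolutely summable, so the series converges
uniformly; its continuous sum equals `φ` almost everywhere because both are the `L²` sum of the same
series. -/
theorem exists_bound_of_sobolevSq_three {φ : L2} (hφ : sobolevSq 3 φ ≠ ∞) :
    ∃ M : ℝ, 0 ≤ M ∧ ∀ j, ∀ᵐ x ∂(volume : Measure T3), |φ x j| ≤ M := by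
  have key : ∀ j, ∀ᵐ x ∂(volume : Measure T3), |φ x j| ≤ ∑' n, ‖fc φ n j‖ := by
    intro j
    have hs := summable_norm_fc hφ j
    have hnorm : ∀ n, ‖fc φ n j • charC n‖ ≤ ‖fc φ n j‖ := by
      intro n
      refine (ContinuousMap.norm_le _ (norm_nonneg _)).mpr fun x => ?_
      change ‖fc φ n j * char n x‖ ≤ _
      rw [norm_mul, norm_char, mul_one]
    have hsum : Summable fun n => fc φ n j • charC n := Summable.of_norm_bounded hs hnorm
    have h1 : HasSum (fun n => fc φ n j • charL n)
        (ContinuousMap.toLp (E := ℂ) 2 (volume : Measure T3) ℂ (∑' n, fc φ n j • charC n)) := by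
      have := (ContinuousMap.toLp (E := ℂ) 2 (volume : Measure T3) ℂ).hasSum hsum.hasSum
      refine this.congr_fun fun n => ?_
      rw [map_smul, charL]
    have h2 : HasSum (fun n => fc φ n j • charL n) (compL φ j) := by
      refine (charBasis.hasSum_repr (compL φ j)).congr_fun fun n => ?_
      rw [HilbertBasis.repr_apply_apply, charBasis, HilbertBasis.coe_mk, inner_smul_left,
        inner_charL_compL, smul_smul, Complex.conj_ofReal]
      congr 1
      have : (normConst : ℂ) ^ 2 = ((2 * Real.pi : ℂ) ^ 3)⁻¹ := by
        rw [← Complex.ofReal_pow, normConst_sq]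
        push_cast
        rfl
      rw [mul_right_comm, ← sq, this, ← mul_assoc, inv_mul_cancel₀ (by simp [Real.pi_ne_zero]),
        one_mul]
    have h3 := h2.unique h1
    filter_upwards [(memLp_comp φ j).coeFn_toLp,
      ContinuousMap.coeFn_toLp (p := 2) (𝕜 := ℂ) (volume : Measure T3)
        (∑' n, fc φ n j • charC n)] with x hx1 hx2
    rw [← h3, compL, hx1] at hx2
    rw [← Real.norm_eq_abs, ← Complex.norm_real, hx2]
    exact (ContinuousMap.norm_coe_le_norm _ x).trans (tsum_of_norm_bounded hs.hasSum hnorm)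
  refine ⟨∑ j, ∑' n, ‖fc φ n j‖, by positivity, fun j => ?_⟩
  filter_upwards [key j] with x hx
  exact hx.trans (Finset.single_le_sum (f := fun j => ∑' n, ‖fc φ n j‖)
    (fun _ _ => by positivity) (Finset.mem_univ j))


/-! ## Measurability in time -/

instance measurableSpaceL2 : MeasurableSpace L2 := borel L2

instance borelSpaceL2 : BorelSpace L2 := ⟨rfl⟩

instance secondCountableL2 : SecondCountableTopology L2 :=
  haveI : Fact ((2 : ℝ≥0∞) ≠ ∞) := ⟨by simp⟩
  inferInstance

/-- The graph of the weak derivative. -/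
def weakDerivGraph (i : Fin 3) : Set (L2 × L2) := {p | IsWeakDeriv i p.1 p.2}

theorem isClosed_weakDerivGraph (i : Fin 3) : IsClosed (weakDerivGraph i) := by
  have h : weakDerivGraph i = ⋂ n : Fin 3 → ℤ, ⋂ j : Fin 3,
      {p | fc p.2 n j = Complex.I * (n i : ℂ) * fc p.1 n j} := by
    ext p
    simp [weakDerivGraph, IsWeakDeriv]
  rw [h]
  exact isClosed_iInter fun n => isClosed_iInter fun j => isClosed_eq
    ((continuous_fc n j).comp continuous_snd)
    (continuous_const.mul ((continuous_fc n j).comp continuous_fst))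

theorem IsWeakDeriv.unique {i : Fin 3} {f g h : L2} (hg : IsWeakDeriv i f g)
    (hh : IsWeakDeriv i f h) : g = h :=
  fc_injective fun n j => (hg n j).trans (hh n j).symm

/-- The closed graph of the weak derivative is Polish and its first projection is injective and
continuous, hence a measurable embedding by Lusin–Souslin. `D i` is the second projection
transported along it and extended by `0`. -/
theorem measurable_D (i : Fin 3) : Measurable (D i) := by
  have hinj : Function.Injective fun p : weakDerivGraph i => p.1.1 := by
    rintro ⟨⟨f, g⟩, hp⟩ ⟨⟨f', g'⟩, hq⟩ (rfl : f = f')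
    have : g = g' := IsWeakDeriv.unique hp hq
    subst this
    rfl
  have : PolishSpace (weakDerivGraph i) := (isClosed_weakDerivGraph i).polishSpace
  have hemb : MeasurableEmbedding fun p : weakDerivGraph i => p.1.1 :=
    (continuous_fst.comp continuous_subtype_val).measurableEmbedding hinj
  have hD : D i = Function.extend (fun p : weakDerivGraph i => p.1.1) (fun p => p.1.2) 0 := by
    funext f
    by_cases h : ∃ g, IsWeakDeriv i f g
    · have h1 : D i f = h.choose := dif_pos h
      rw [h1]
      exact (hinj.extend_apply (fun p : weakDerivGraph i => p.1.2) 0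
        ⟨(f, h.choose), h.choose_spec⟩).symm
    · have h1 : D i f = 0 := dif_neg h
      rw [h1, Function.extend_apply']
      · rfl
      · rintro ⟨⟨⟨f', g⟩, hg⟩, rfl⟩
        exact h ⟨g, hg⟩
  rw [hD]
  exact hemb.measurable_extend (measurable_snd.comp measurable_subtype_coe) measurable_const

/-- Pairing with a dense sequence embeds `L²` continuously and injectively into a countable product
of lines; by Lusin–Souslin, measurability can be tested there. -/
theorem measurable_of_weak_continuous {v : ℝ → L2}
    (hv : ∀ h : L2, Continuous fun t => (inner ℝ (v t) h : ℝ)) : Measurable v := by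
  have hinj : Function.Injective fun (f : L2) (k : ℕ) =>
      (inner ℝ f (TopologicalSpace.denseSeq L2 k) : ℝ) := by
    intro f g hfg
    refine ext_inner_right ℝ fun h => ?_
    exact congrFun ((TopologicalSpace.denseRange_denseSeq L2).equalizer
      (by fun_prop : Continuous fun h : L2 => (inner ℝ f h : ℝ))
      (by fun_prop : Continuous fun h : L2 => (inner ℝ g h : ℝ)) hfg) h
  have hemb : MeasurableEmbedding fun (f : L2) (k : ℕ) =>
      (inner ℝ f (TopologicalSpace.denseSeq L2 k) : ℝ) :=
    Continuous.measurableEmbedding (by fun_prop) hinj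
  refine hemb.measurable_comp_iff.mp (measurable_pi_iff.mpr fun k => ?_)
  exact (hv _).measurable

/-! ## Integrability of the drift -/

theorem integrable_of_quadratic_bound {F : L2 → ℝ} (hF : Measurable F) {c₀ c₁ : ℝ} (hc₁ : 0 ≤ c₁)
    (hb : ∀ f, |F f| ≤ c₀ + c₁ * (‖f‖ ^ 2 + ∑ i, ‖D i f‖ ^ 2)) {u : ℝ → L2}
    (hw : ∀ h : L2, ContinuousOn (fun t => (inner ℝ (u t) h : ℝ)) (Ici 0)) {τ : ℝ}
    (hS : ∫⁻ t in Icc 0 τ, sobolevSq 1 (u t) < ∞) :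
    IntegrableOn (fun t => F (u t)) (Icc 0 τ) := by
  -- Nothing is known about `u` at negative times, so it is frozen there at its initial value.
  have hm : Measurable fun t => u (max t 0) := by
    refine measurable_of_weak_continuous fun h => ?_
    exact (hw h).comp_continuous (by fun_prop) fun t => le_max_right t 0
  have hmeas : AEStronglyMeasurable (fun t => F (u t)) (volume.restrict (Icc 0 τ)) := by
    refine (hF.comp hm).aestronglyMeasurable.congr ?_
    filter_upwards [ae_restrict_mem measurableSet_Icc] with t ht
    simp [max_eq_left ht.1]
  refine ⟨hmeas, ?_⟩
  have hle : ∀ t, ‖F (u t)‖ₑ ≤ ENNReal.ofReal c₀ + ENNReal.ofReal c₁ * 4 * sobolevSq 1 (u t) := by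
    intro t
    rw [← ofReal_norm, Real.norm_eq_abs]
    refine (ENNReal.ofReal_le_ofReal (hb (u t))).trans (ENNReal.ofReal_add_le.trans ?_)
    gcongr
    rw [ENNReal.ofReal_mul hc₁, mul_assoc]
    gcongr
    rw [ENNReal.ofReal_add (by positivity) (by positivity),
      ENNReal.ofReal_sum_of_nonneg fun i _ => by positivity]
    calc ENNReal.ofReal (‖u t‖ ^ 2) + ∑ i, ENNReal.ofReal (‖D i (u t)‖ ^ 2)
        ≤ sobolevSq 1 (u t) + ∑ _i : Fin 3, sobolevSq 1 (u t) :=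
          add_le_add (norm_sq_le_sobolevSq _)
            (Finset.sum_le_sum fun i _ => norm_D_sq_le_sobolevSq i _)
      _ = 4 * sobolevSq 1 (u t) := by
          simp only [Finset.sum_const, Finset.card_univ, Fintype.card_fin, nsmul_eq_mul]
          push_cast
          ring
  refine (lintegral_mono hle).trans_lt ?_
  -- These two rules require no measurability of `t ↦ sobolevSq 1 (u t)`.
  rw [lintegral_add_left measurable_const,
    lintegral_const_mul' _ _ (ENNReal.mul_ne_top ENNReal.ofReal_ne_top (by simp))]
  refine ENNReal.add_lt_top.mpr ⟨?_, ENNReal.mul_lt_top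
    (ENNReal.mul_lt_top ENNReal.ofReal_lt_top (by simp)) hS⟩
  simp [ENNReal.mul_lt_top]

theorem measurable_gradInner (φ : L2) : Measurable fun f => gradInner f φ := by
  unfold gradInner
  refine Finset.measurable_sum _ fun i _ => ?_
  exact (by fun_prop : Continuous fun g : L2 => (inner ℝ g (D i φ) : ℝ)).measurable.comp
    (measurable_D i)

theorem gradInner_self (f : L2) : gradInner f f = ∑ i, ‖D i f‖ ^ 2 := by
  simp [gradInner]

theorem measurable_gradInner_self : Measurable fun f => gradInner f f := by
  simp only [gradInner_self]
  exact Finset.measurable_sum _ fun i _ => ((measurable_D i).norm.pow_const 2)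

theorem abs_gradInner_le (f φ : L2) :
    |gradInner f φ| ≤ ∑ i, ‖D i f‖ ^ 2 + ∑ i, ‖D i φ‖ ^ 2 := by
  rw [gradInner, ← Finset.sum_add_distrib]
  refine (Finset.abs_sum_le_sum_abs _ _).trans (Finset.sum_le_sum fun i _ => ?_)
  refine (abs_real_inner_le_norm _ _).trans ?_
  nlinarith [sq_nonneg (‖D i f‖ - ‖D i φ‖), sq_nonneg ‖D i f‖, sq_nonneg ‖D i φ‖]

theorem integral_norm_mul_norm_le (f g : L2) :
    Integrable (fun x => ‖f x‖ * ‖g x‖) (volume : Measure T3) ∧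
      ∫ x, ‖f x‖ * ‖g x‖ ≤ ‖f‖ * ‖g‖ := by
  have hf := (Lp.memLp f).norm
  have hg := (Lp.memLp g).norm
  refine ⟨hf.integrable_mul hg, ?_⟩
  have h := real_inner_le_norm (hf.toLp _) (hg.toLp _)
  rw [MeasureTheory.L2.inner_def, Lp.norm_toLp, Lp.norm_toLp, eLpNorm_norm, eLpNorm_norm,
    ← Lp.norm_def, ← Lp.norm_def] at h
  refine le_of_eq_of_le (integral_congr_ae ?_) h
  filter_upwards [hf.coeFn_toLp, hg.coeFn_toLp] with x h1 h2
  rw [h1, h2, RCLike.inner_apply, conj_trivial, mul_comm]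

theorem integrable_triple (f g : L2) {φ : L2} {M : ℝ} {j : Fin 3}
    (hM : ∀ᵐ x ∂(volume : Measure T3), |φ x j| ≤ M) (i : Fin 3) :
    Integrable (fun x => f x i * g x j * φ x j) (volume : Measure T3) := by
  have hf := (Lp.memLp f).continuousLinearMap_comp (EuclideanSpace.proj (𝕜 := ℝ) i : E3 →L[ℝ] ℝ)
  have hg := (Lp.memLp g).continuousLinearMap_comp (EuclideanSpace.proj (𝕜 := ℝ) j : E3 →L[ℝ] ℝ)
  have hfg : Integrable (fun x => f x i * g x j) (volume : Measure T3) := hf.integrable_mul hg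
  exact hfg.mul_bdd (c := M) (integrable_comp φ j).1 hM

theorem abs_integral_triple_le (f g : L2) {φ : L2} {M : ℝ} (hM0 : 0 ≤ M) {j : Fin 3}
    (hM : ∀ᵐ x ∂(volume : Measure T3), |φ x j| ≤ M) (i : Fin 3) :
    |∫ x, f x i * g x j * φ x j| ≤ M * ‖f‖ * ‖g‖ := by
  obtain ⟨hi, hle⟩ := integral_norm_mul_norm_le f g
  calc |∫ x, f x i * g x j * φ x j| ≤ ∫ x, M * (‖f x‖ * ‖g x‖) := by
        rw [← Real.norm_eq_abs]
        refine norm_integral_le_of_norm_le (hi.const_mul M) ?_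
        filter_upwards [hM] with x hx
        rw [norm_mul, norm_mul, mul_comm M]
        exact mul_le_mul (mul_le_mul (PiLp.norm_apply_le (f x) i) (PiLp.norm_apply_le (g x) j)
          (norm_nonneg _) (norm_nonneg _)) hx (norm_nonneg _) (by positivity)
    _ ≤ M * (‖f‖ * ‖g‖) := by
        rw [integral_const_mul]
        gcongr
    _ = M * ‖f‖ * ‖g‖ := by ring

theorem continuous_integral_triple {φ : L2} {M : ℝ} (hM0 : 0 ≤ M) {j : Fin 3}
    (hM : ∀ᵐ x ∂(volume : Measure T3), |φ x j| ≤ M) (i : Fin 3) :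
    Continuous fun p : L2 × L2 => ∫ x, p.1 x i * p.2 x j * φ x j := by
  let B : L2 →ₗ[ℝ] L2 →ₗ[ℝ] ℝ := LinearMap.mk₂ ℝ (fun f g => ∫ x, f x i * g x j * φ x j)
    (by
      intro f f' g
      rw [← integral_add (integrable_triple f g hM i) (integrable_triple f' g hM i)]
      refine integral_congr_ae ?_
      filter_upwards [Lp.coeFn_add f f'] with x hx
      rw [hx]
      simp [add_mul])
    (by
      intro c f g
      rw [smul_eq_mul, ← integral_const_mul]
      refine integral_congr_ae ?_
      filter_upwards [Lp.coeFn_smul (p := 2) (μ := (volume : Measure T3)) c f] with x hx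
      rw [hx]
      simp [mul_assoc])
    (by
      intro f g g'
      rw [← integral_add (integrable_triple f g hM i) (integrable_triple f g' hM i)]
      refine integral_congr_ae ?_
      filter_upwards [Lp.coeFn_add g g'] with x hx
      rw [hx]
      simp [add_mul, mul_add])
    (by
      intro c f g
      rw [smul_eq_mul, ← integral_const_mul]
      refine integral_congr_ae ?_
      filter_upwards [Lp.coeFn_smul (p := 2) (μ := (volume : Measure T3)) c g] with x hx
      rw [hx]
      simp only [Pi.smul_apply, PiLp.smul_apply, smul_eq_mul]
      ring)
  exact (B.mkContinuous₂ M fun f g => abs_integral_triple_le f g hM0 hM i).continuous₂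

theorem trilin_eq_sum (f g : L2) {φ : L2} {M : ℝ}
    (hM : ∀ j, ∀ᵐ x ∂(volume : Measure T3), |φ x j| ≤ M) :
    trilin f g φ = ∑ i, ∑ j, ∫ x, f x i * D i g x j * φ x j := by
  unfold trilin
  rw [integral_finsetSum _ fun i _ => integrable_finsetSum _ fun j _ =>
    integrable_triple f (D i g) (hM j) i]
  exact Finset.sum_congr rfl fun i _ =>
    integral_finsetSum _ fun j _ => integrable_triple f (D i g) (hM j) i

/-- For bounded `φ` the form is a finite sum of continuous bilinear forms evaluated at `(f, D i f)`.
-/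
theorem measurable_trilin_self {φ : L2} {M : ℝ} (hM0 : 0 ≤ M)
    (hM : ∀ j, ∀ᵐ x ∂(volume : Measure T3), |φ x j| ≤ M) :
    Measurable fun f => trilin f f φ := by
  simp only [trilin_eq_sum _ _ hM]
  refine Finset.measurable_sum _ fun i _ => Finset.measurable_sum _ fun j _ => ?_
  exact (continuous_integral_triple hM0 (hM j) i).measurable.comp
    (measurable_id.prodMk (measurable_D i))

theorem abs_trilin_self_le {φ : L2} {M : ℝ} (hM0 : 0 ≤ M)
    (hM : ∀ j, ∀ᵐ x ∂(volume : Measure T3), |φ x j| ≤ M) (f : L2) :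
    |trilin f f φ| ≤ 9 * M * (‖f‖ ^ 2 + ∑ i, ‖D i f‖ ^ 2) := by
  rw [trilin_eq_sum _ _ hM]
  have h1 : ∀ i j, |∫ x, f x i * D i f x j * φ x j| ≤ M * (‖f‖ ^ 2 + ∑ i, ‖D i f‖ ^ 2) := by
    intro i j
    refine (abs_integral_triple_le f (D i f) hM0 (hM j) i).trans ?_
    rw [mul_assoc]
    gcongr
    have := Finset.single_le_sum (f := fun i => ‖D i f‖ ^ 2) (fun _ _ => sq_nonneg _)
      (Finset.mem_univ i)
    nlinarith [sq_nonneg (‖f‖ - ‖D i f‖), sq_nonneg ‖f‖, sq_nonneg ‖D i f‖]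
  calc |∑ i, ∑ j, ∫ x, f x i * D i f x j * φ x j|
      ≤ ∑ i, ∑ j, |∫ x, f x i * D i f x j * φ x j| :=
        (Finset.abs_sum_le_sum_abs _ _).trans
          (Finset.sum_le_sum fun i _ => Finset.abs_sum_le_sum_abs _ _)
    _ ≤ ∑ _i : Fin 3, ∑ _j : Fin 3, M * (‖f‖ ^ 2 + ∑ i, ‖D i f‖ ^ 2) :=
        Finset.sum_le_sum fun i _ => Finset.sum_le_sum fun j _ => h1 i j
    _ = 9 * M * (‖f‖ ^ 2 + ∑ i, ‖D i f‖ ^ 2) := by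
        simp only [Finset.sum_const, Finset.card_univ, Fintype.card_fin, nsmul_eq_mul]
        push_cast
        ring

theorem leray_eq_self {φ : L2} (hφ : φ ∈ H0) : leray φ = φ :=
  Submodule.starProjection_eq_self_iff.mpr hφ

/-- A divergence-free `φ` is fixed by the projection and is bounded when it lies in `H³`, so the
drift is at most quadratic in the `W^{1,2}` norm of `u`. -/
theorem integrableOn_drift {u : ℝ → L2}
    (hw : ∀ h : L2, ContinuousOn (fun t => (inner ℝ (u t) h : ℝ)) (Ici 0)) {τ : ℝ}
    (hS : ∫⁻ t in Icc 0 τ, sobolevSq 1 (u t) < ∞) {φ : L2} (hφ : φ ∈ Hs 3) :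
    IntegrableOn (fun r => gradInner (u r) φ + BP (u r) φ) (Icc 0 τ) := by
  obtain ⟨M, hM0, hM⟩ := exists_bound_of_sobolevSq_three hφ.2
  refine integrable_of_quadratic_bound (F := fun f => gradInner f φ + BP f φ)
    (c₀ := ∑ i, ‖D i φ‖ ^ 2) (c₁ := 1 + 9 * M) ?_ (by positivity) (fun f => ?_) hw hS
  · simp only [BP, leray_eq_self hφ.1]
    exact (measurable_gradInner φ).add (measurable_trilin_self hM0 hM)
  · simp only [BP, leray_eq_self hφ.1]
    have h1 := abs_add_le (gradInner f φ) (trilin f f φ)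
    have h2 := abs_gradInner_le f φ
    have h3 := abs_trilin_self_le hM0 hM f
    nlinarith [sq_nonneg ‖f‖]

theorem integrableOn_gradInner_self {u : ℝ → L2}
    (hw : ∀ h : L2, ContinuousOn (fun t => (inner ℝ (u t) h : ℝ)) (Ici 0)) {τ : ℝ}
    (hS : ∫⁻ t in Icc 0 τ, sobolevSq 1 (u t) < ∞) :
    IntegrableOn (fun r => gradInner (u r) (u r)) (Icc 0 τ) := by
  refine integrable_of_quadratic_bound (F := fun f => gradInner f f)
    (c₀ := 0) (c₁ := 1) measurable_gradInner_self zero_le_one (fun f => ?_) hw hS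
  rw [gradInner_self, abs_of_nonneg (by positivity)]
  linarith [sq_nonneg ‖f‖]


/-! ## The energy inequality of a concatenation -/

theorem antitone_comp_max {E : ℝ → ℝ} (hE : AntitoneOn E (Ici 0)) :
    Antitone fun r => E (max r 0) := fun _ _ h =>
  hE (mem_Ici.mpr (le_max_right _ _)) (mem_Ici.mpr (le_max_right _ _)) (max_le_max_right 0 h)

theorem tendsto_lim_left {E : ℝ → ℝ} (hE : AntitoneOn E (Ici 0)) (t : ℝ) :
    Tendsto (fun r => E (max r 0)) (𝓝[<] t) (𝓝 (lim_left E t)) :=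
  (antitone_comp_max hE).tendsto_leftLim t

theorem tendsto_lim_right {E : ℝ → ℝ} (hE : AntitoneOn E (Ici 0)) (t : ℝ) :
    Tendsto (fun r => E (max r 0)) (𝓝[>] t) (𝓝 (lim_right E t)) :=
  (antitone_comp_max hE).tendsto_rightLim t

theorem lim_left_zero {E : ℝ → ℝ} (hE : AntitoneOn E (Ici 0)) : lim_left E 0 = E 0 := by
  refine tendsto_nhds_unique (tendsto_lim_left hE 0) (tendsto_const_nhds.congr' ?_)
  filter_upwards [self_mem_nhdsWithin] with r hr
  rw [max_eq_right (le_of_lt hr)]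

/-- A left neighbourhood of `T` has positive measure, so it meets every set of full measure. This
makes essential left limits unique. -/
theorem neBot_nhdsLT_inf_ae (T : ℝ) : (𝓝[<] T ⊓ ae (volume : Measure ℝ)).NeBot := by
  refine Filter.inf_neBot_iff.mpr fun {s} hs {t} ht => ?_
  obtain ⟨a, ha, hs⟩ := (mem_nhdsLT_iff_exists_Ioo_subset).mp hs
  by_contra hne
  rw [Set.not_nonempty_iff_eq_empty] at hne
  have h1 : Ioo a T ⊆ tᶜ := fun x hx hxt => by
    have : x ∈ s ∩ t := ⟨hs hx, hxt⟩
    simp [hne] at this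
  have h2 : volume (Ioo a T) = 0 := measure_mono_null h1 (mem_ae_iff.mp ht)
  rw [Real.volume_Ioo, ENNReal.ofReal_eq_zero] at h2
  have : a < T := ha
  linarith

theorem IsEssLeftLim.eq_lim_left {E E₁ : ℝ → ℝ} {T l : ℝ} (hT : 0 < T) (hl : IsEssLeftLim E T l)
    (hE₁ : AntitoneOn E₁ (Ici 0)) (h : E₁ =ᵐ[volume.restrict (Ici 0)] E) : l = lim_left E₁ T := by
  have hne := neBot_nhdsLT_inf_ae T
  refine tendsto_nhds_unique hl (((tendsto_lim_left hE₁ T).mono_left inf_le_left).congr' ?_)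
  rw [EventuallyEq, ae_restrict_iff' measurableSet_Ici] at h
  have h0 : ∀ᶠ r in 𝓝[<] T, 0 < r := mem_nhdsWithin_of_mem_nhds (Ioi_mem_nhds hT)
  filter_upwards [Filter.mem_inf_of_left h0, Filter.mem_inf_of_right h] with r h1 h2
  rw [max_eq_left h1.le, h2 h1.le]

/-- The concatenation of two energies whose value at the time `T` is given by the second one. -/
def concatEnergy (T : ℝ) (E₁ E₂ : ℝ → ℝ) (t : ℝ) : ℝ := if t < T then E₁ t else E₂ (t - T)

theorem concatEnergy_of_lt {T : ℝ} {E₁ E₂ : ℝ → ℝ} {t : ℝ} (h : t < T) :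
    concatEnergy T E₁ E₂ t = E₁ t := if_pos h

theorem concatEnergy_of_le {T : ℝ} {E₁ E₂ : ℝ → ℝ} {t : ℝ} (h : T ≤ t) :
    concatEnergy T E₁ E₂ t = E₂ (t - T) := if_neg h.not_gt

section

variable {T : ℝ} {E₁ E₂ : ℝ → ℝ}

/-- Across `T`, earlier values lie above the left limit of `E₁` and later ones below `E₂ 0`. -/
theorem antitoneOn_concatEnergy (h₁ : AntitoneOn E₁ (Ici 0)) (h₂ : AntitoneOn E₂ (Ici 0))
    (h : E₂ 0 ≤ lim_left E₁ T) : AntitoneOn (concatEnergy T E₁ E₂) (Ici 0) := by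
  intro s hs t ht hst
  rcases lt_or_ge t T with htT | htT
  · rw [concatEnergy_of_lt htT, concatEnergy_of_lt (hst.trans_lt htT)]
    exact h₁ hs ht hst
  rw [concatEnergy_of_le htT]
  rcases lt_or_ge s T with hsT | hsT
  · rw [concatEnergy_of_lt hsT]
    have h3 : lim_left E₁ T ≤ E₁ (max s 0) := (antitone_comp_max h₁).leftLim_le hsT
    rw [max_eq_left hs] at h3
    exact (h₂ self_mem_Ici (sub_nonneg.mpr htT) (sub_nonneg.mpr htT)).trans (h.trans h3)
  · rw [concatEnergy_of_le hsT]
    exact h₂ (sub_nonneg.mpr hsT) (sub_nonneg.mpr htT) (by linarith)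

theorem lim_left_concatEnergy_of_le (hT : 0 < T) (h₁ : AntitoneOn E₁ (Ici 0))
    (hc : AntitoneOn (concatEnergy T E₁ E₂) (Ici 0)) {t : ℝ} (ht : t ≤ T) :
    lim_left (concatEnergy T E₁ E₂) t = lim_left E₁ t := by
  refine tendsto_nhds_unique (tendsto_lim_left hc t) ((tendsto_lim_left h₁ t).congr' ?_)
  filter_upwards [self_mem_nhdsWithin] with r hr
  rw [concatEnergy_of_lt (max_lt (lt_of_lt_of_le hr ht) hT)]

theorem lim_right_concatEnergy_of_lt (hT : 0 < T) (h₁ : AntitoneOn E₁ (Ici 0))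
    (hc : AntitoneOn (concatEnergy T E₁ E₂) (Ici 0)) {t : ℝ} (ht : t < T) :
    lim_right (concatEnergy T E₁ E₂) t = lim_right E₁ t := by
  refine tendsto_nhds_unique (tendsto_lim_right hc t) ((tendsto_lim_right h₁ t).congr' ?_)
  filter_upwards [mem_nhdsWithin_of_mem_nhds (Iio_mem_nhds ht)] with r hr
  rw [concatEnergy_of_lt (max_lt hr hT)]

theorem concatEnergy_max (hT : 0 < T) {r : ℝ} (hr : T ≤ r) :
    E₂ (max (r - T) 0) = concatEnergy T E₁ E₂ (max r 0) := by
  rw [max_eq_left (by linarith), max_eq_left (by linarith), concatEnergy_of_le hr]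

theorem lim_left_concatEnergy_of_lt (hT : 0 < T) (h₂ : AntitoneOn E₂ (Ici 0))
    (hc : AntitoneOn (concatEnergy T E₁ E₂) (Ici 0)) {t : ℝ} (ht : T < t) :
    lim_left (concatEnergy T E₁ E₂) t = lim_left E₂ (t - T) := by
  have hm : Tendsto (fun r => r - T) (𝓝[<] t) (𝓝[<] (t - T)) := by
    refine tendsto_nhdsWithin_iff.mpr ⟨?_, ?_⟩
    · exact ((continuous_id.sub continuous_const).tendsto t).mono_left nhdsWithin_le_nhds
    · filter_upwards [self_mem_nhdsWithin] with r hr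
      exact sub_lt_sub_right hr T
  refine tendsto_nhds_unique (tendsto_lim_left hc t)
    (((tendsto_lim_left h₂ (t - T)).comp hm).congr' ?_)
  filter_upwards [mem_nhdsWithin_of_mem_nhds (Ioi_mem_nhds ht)] with r hr
  exact concatEnergy_max hT (le_of_lt hr)

theorem lim_right_concatEnergy_of_le (hT : 0 < T) (h₂ : AntitoneOn E₂ (Ici 0))
    (hc : AntitoneOn (concatEnergy T E₁ E₂) (Ici 0)) {t : ℝ} (ht : T ≤ t) :
    lim_right (concatEnergy T E₁ E₂) t = lim_right E₂ (t - T) := by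
  have hm : Tendsto (fun r => r - T) (𝓝[>] t) (𝓝[>] (t - T)) := by
    refine tendsto_nhdsWithin_iff.mpr ⟨?_, ?_⟩
    · exact ((continuous_id.sub continuous_const).tendsto t).mono_left nhdsWithin_le_nhds
    · filter_upwards [self_mem_nhdsWithin] with r hr
      exact sub_lt_sub_right hr T
  refine tendsto_nhds_unique (tendsto_lim_right hc t)
    (((tendsto_lim_right h₂ (t - T)).comp hm).congr' ?_)
  filter_upwards [self_mem_nhdsWithin] with r hr
  exact concatEnergy_max hT (ht.trans (le_of_lt hr))

end

/-- The energy inequality with dissipation rate `G`. -/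
def EnergyInequality (E G : ℝ → ℝ) : Prop :=
  ∀ τ₁ τ₂, 0 ≤ τ₁ → τ₁ ≤ τ₂ → ∀ ψ : ℝ → ℝ, ContDiff ℝ 1 ψ → HasCompactSupport ψ →
    (∀ t, 0 ≤ t → 0 ≤ ψ t) →
    (lim_right E τ₂ * ψ τ₂ - lim_left E τ₁ * ψ τ₁) - (∫ t in τ₁..τ₂, E t * deriv ψ t)
      + (∫ t in τ₁..τ₂, ψ t * G t) ≤ 0

theorem intervalIntegrable_energy_mul {E ψ : ℝ → ℝ} (hE : AntitoneOn E (Ici 0))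
    (hψ : ContDiff ℝ 1 ψ) {a b : ℝ} (ha : 0 ≤ a) (hab : a ≤ b) :
    IntervalIntegrable (fun t => E t * deriv ψ t) volume a b := by
  refine IntervalIntegrable.mul_continuousOn ?_ (hψ.continuous_deriv le_rfl).continuousOn
  refine AntitoneOn.intervalIntegrable (hE.mono ?_)
  rw [uIcc_of_le hab]
  exact fun x hx => ha.trans hx.1

theorem intervalIntegrable_mul_dissipation {G ψ : ℝ → ℝ}
    (hG : ∀ τ, 0 < τ → IntegrableOn G (Icc 0 τ))
    (hψ : ContDiff ℝ 1 ψ) {a b : ℝ} (ha : 0 ≤ a) (hab : a ≤ b) :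
    IntervalIntegrable (fun t => ψ t * G t) volume a b := by
  refine IntervalIntegrable.continuousOn_mul ?_ hψ.continuous.continuousOn
  rw [intervalIntegrable_iff_integrableOn_Icc_of_le hab]
  exact (hG (b + 1) (by linarith)).mono_set (Icc_subset_Icc ha (by linarith))

/-- Let the upper endpoint `τ` increase to `T`: the integrals are continuous in `τ`, and by
monotonicity the right limit at each `τ < T` is at least the left limit at `T`. -/
theorem EnergyInequality.left {E G : ℝ → ℝ} (h : EnergyInequality E G)
    (hE : AntitoneOn E (Ici 0)) (hG : ∀ τ, 0 < τ → IntegrableOn G (Icc 0 τ)) {τ₁ T : ℝ}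
    (h0 : 0 ≤ τ₁) (hτ : τ₁ ≤ T) {ψ : ℝ → ℝ} (hψ : ContDiff ℝ 1 ψ) (hc : HasCompactSupport ψ)
    (hψ0 : ∀ t, 0 ≤ t → 0 ≤ ψ t) :
    (lim_left E T * ψ T - lim_left E τ₁ * ψ τ₁) - (∫ t in τ₁..T, E t * deriv ψ t)
      + (∫ t in τ₁..T, ψ t * G t) ≤ 0 := by
  rcases hτ.eq_or_lt with rfl | hlt
  · simp
  have hne : (𝓝[Ioo τ₁ T] T).NeBot := by
    rw [nhdsWithin_Ioo_eq_nhdsLT hlt]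
    infer_instance
  have hmem : T ∈ uIcc τ₁ T := right_mem_uIcc
  have hsub : Ioo τ₁ T ⊆ uIcc τ₁ T := by
    rw [uIcc_of_le hτ]
    exact Ioo_subset_Icc_self
  have c1 : Tendsto (fun τ => ∫ t in τ₁..τ, E t * deriv ψ t) (𝓝[Ioo τ₁ T] T)
      (𝓝 (∫ t in τ₁..T, E t * deriv ψ t)) :=
    ((intervalIntegral.continuousOn_primitive_interval' (intervalIntegrable_energy_mul hE hψ h0 hτ)
      left_mem_uIcc) T hmem).mono hsub
  have c2 : Tendsto (fun τ => ∫ t in τ₁..τ, ψ t * G t) (𝓝[Ioo τ₁ T] T)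
      (𝓝 (∫ t in τ₁..T, ψ t * G t)) :=
    ((intervalIntegral.continuousOn_primitive_interval'
      (intervalIntegrable_mul_dissipation hG hψ h0 hτ) left_mem_uIcc) T hmem).mono hsub
  have c3 : Tendsto ψ (𝓝[Ioo τ₁ T] T) (𝓝 (ψ T)) :=
    (hψ.continuous.tendsto T).mono_left nhdsWithin_le_nhds
  refine le_of_tendsto ((((c3.const_mul (lim_left E T)).sub_const _).sub c1).add c2) ?_
  filter_upwards [self_mem_nhdsWithin] with τ hτ'
  have h1 := h τ₁ τ h0 hτ'.1.le ψ hψ hc hψ0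
  have h2 : lim_left E T ≤ lim_right E τ := (antitone_comp_max hE).leftLim_le_rightLim hτ'.2
  have h3 := mul_le_mul_of_nonneg_right h2 (hψ0 τ (h0.trans hτ'.1.le))
  linarith

/-- Apply the inequality to the translated test function `ψ (· + T)` and change variables. -/
theorem EnergyInequality.shift {E G : ℝ → ℝ} (h : EnergyInequality E G) {τ₁ τ₂ T : ℝ}
    (hT : 0 ≤ T) (h0 : T ≤ τ₁) (hτ : τ₁ ≤ τ₂) {ψ : ℝ → ℝ} (hψ : ContDiff ℝ 1 ψ)
    (hc : HasCompactSupport ψ) (hψ0 : ∀ t, 0 ≤ t → 0 ≤ ψ t) :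
    (lim_right E (τ₂ - T) * ψ τ₂ - lim_left E (τ₁ - T) * ψ τ₁)
      - (∫ t in τ₁..τ₂, E (t - T) * deriv ψ t) + (∫ t in τ₁..τ₂, ψ t * G (t - T)) ≤ 0 := by
  have h1 := h (τ₁ - T) (τ₂ - T) (by linarith) (by linarith) (fun t => ψ (t + T))
    (hψ.comp (contDiff_id.add contDiff_const)) (hc.comp_homeomorph (Homeomorph.addRight T))
    fun t ht => hψ0 _ (by linarith)
  simp only [sub_add_cancel] at h1
  rw [← intervalIntegral.integral_comp_sub_right, ← intervalIntegral.integral_comp_sub_right] at h1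
  simpa only [deriv_comp_add_const, sub_add_cancel] using h1

theorem EnergyInequality.concat {E₁ E₂ G₁ G₂ G : ℝ → ℝ} {T : ℝ} (hT : 0 < T)
    (h₁ : EnergyInequality E₁ G₁) (h₂ : EnergyInequality E₂ G₂)
    (hE₁ : AntitoneOn E₁ (Ici 0)) (hE₂ : AntitoneOn E₂ (Ici 0)) (h : E₂ 0 ≤ lim_left E₁ T)
    (hG₁ : ∀ τ, 0 < τ → IntegrableOn G₁ (Icc 0 τ)) (hG : ∀ τ, 0 < τ → IntegrableOn G (Icc 0 τ))
    (hleft : ∀ t, t ≤ T → G t = G₁ t) (hright : ∀ t, T ≤ t → G t = G₂ (t - T)) :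
    EnergyInequality (concatEnergy T E₁ E₂) G := by
  intro τ₁ τ₂ h0 hτ ψ hψ hc hψ0
  have hE := antitoneOn_concatEnergy hE₁ hE₂ h
  have left1 : ∀ b, τ₁ ≤ b → b ≤ T → ∫ t in τ₁..b, concatEnergy T E₁ E₂ t * deriv ψ t =
      ∫ t in τ₁..b, E₁ t * deriv ψ t := by
    intro b hb hbT
    -- The integrands may differ at `b = T`, where `concatEnergy` follows `E₂`; hence the passage to
    -- the open interval.
    rw [intervalIntegral.integral_of_le hb, intervalIntegral.integral_of_le hb,
      integral_Ioc_eq_integral_Ioo, integral_Ioc_eq_integral_Ioo]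
    refine setIntegral_congr_fun measurableSet_Ioo fun t ht => ?_
    simp only [concatEnergy_of_lt (ht.2.trans_le hbT)]
  have left2 : ∀ b, τ₁ ≤ b → b ≤ T → ∫ t in τ₁..b, ψ t * G t = ∫ t in τ₁..b, ψ t * G₁ t := by
    intro b hb hbT
    refine intervalIntegral.integral_congr fun t ht => ?_
    rw [uIcc_of_le hb] at ht
    simp only [hleft t (ht.2.trans hbT)]
  have right1 : ∀ a, T ≤ a → a ≤ τ₂ → ∫ t in a..τ₂, concatEnergy T E₁ E₂ t * deriv ψ t =
      ∫ t in a..τ₂, E₂ (t - T) * deriv ψ t := by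
    intro a hTa ha
    refine intervalIntegral.integral_congr fun t ht => ?_
    rw [uIcc_of_le ha] at ht
    simp only [concatEnergy_of_le (hTa.trans ht.1)]
  have right2 : ∀ a, T ≤ a → a ≤ τ₂ → ∫ t in a..τ₂, ψ t * G t =
      ∫ t in a..τ₂, ψ t * G₂ (t - T) := by
    intro a hTa ha
    refine intervalIntegral.integral_congr fun t ht => ?_
    rw [uIcc_of_le ha] at ht
    simp only [hright t (hTa.trans ht.1)]
  rcases lt_or_ge τ₂ T with h2T | h2T
  · rw [left1 τ₂ hτ h2T.le, left2 τ₂ hτ h2T.le, lim_right_concatEnergy_of_lt hT hE₁ hE h2T,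
      lim_left_concatEnergy_of_le hT hE₁ hE (hτ.trans h2T.le)]
    exact h₁ τ₁ τ₂ h0 hτ ψ hψ hc hψ0
  rw [lim_right_concatEnergy_of_le hT hE₂ hE h2T]
  rcases lt_or_ge T τ₁ with h1T | h1T
  · rw [right1 τ₁ h1T.le hτ, right2 τ₁ h1T.le hτ, lim_left_concatEnergy_of_lt hT hE₂ hE h1T]
    exact h₂.shift hT.le h1T.le hτ hψ hc hψ0
  · rw [lim_left_concatEnergy_of_le hT hE₁ hE h1T,
      ← intervalIntegral.integral_add_adjacent_intervals
        (intervalIntegrable_energy_mul hE hψ h0 h1T)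
        (intervalIntegrable_energy_mul hE hψ hT.le h2T),
      ← intervalIntegral.integral_add_adjacent_intervals
        (intervalIntegrable_mul_dissipation hG hψ h0 h1T)
        (intervalIntegrable_mul_dissipation hG hψ hT.le h2T),
      left1 T h1T le_rfl, left2 T h1T le_rfl, right1 T le_rfl h2T, right2 T le_rfl h2T]
    have e1 := h₁.left hE₁ hG₁ h0 h1T hψ hc hψ0
    have e2 := h₂.shift hT.le le_rfl h2T hψ hc hψ0
    rw [sub_self, lim_left_zero hE₂] at e2
    -- The jump at `T` is downward, so the boundary terms left over from the two pieces have the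
    -- favourable sign.
    have e3 := mul_le_mul_of_nonneg_right h (hψ0 T hT.le)
    linarith


/-! ## Controls -/

theorem IsControl.add {J : Set ℝ} {ω₁ ω₂ : ℝ → ℝ → ℝ} (h₁ : IsControl J ω₁) (h₂ : IsControl J ω₂) :
    IsControl J fun s t => ω₁ s t + ω₂ s t where
  nonneg s hs t ht hst := add_nonneg (h₁.nonneg s hs t ht hst) (h₂.nonneg s hs t ht hst)
  cont := h₁.cont.add h₂.cont
  diag s hs := by rw [h₁.diag s hs, h₂.diag s hs, add_zero]
  superadd s hs θ hθ t ht h h' := by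
    linarith [h₁.superadd s hs θ hθ t ht h h', h₂.superadd s hs θ hθ t ht h h']

/-- Used with the truncated times `min s T` and `max (s - T) 0`, to extend the controls of the two
pieces to the whole time axis. -/
theorem IsControl.comp {I J : Set ℝ} {ω : ℝ → ℝ → ℝ} (h : IsControl J ω) {k : ℝ → ℝ}
    (hk : Continuous k) (hm : Monotone k) (hJ : MapsTo k I J) :
    IsControl I fun s t => ω (k s) (k t) where
  nonneg s hs t ht hst := h.nonneg _ (hJ hs) _ (hJ ht) (hm hst)
  cont := h.cont.comp (f := fun q : ℝ × ℝ => (k q.1, k q.2)) (by fun_prop)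
    fun _ hq => ⟨hJ hq.1, hJ hq.2.1, hm hq.2.2⟩
  diag s hs := h.diag _ (hJ hs)
  superadd s hs θ hθ t ht h1 h2 := h.superadd _ (hJ hs) _ (hJ hθ) _ (hJ ht) (hm h1) (hm h2)

theorem isControl_increment {h : ℝ → ℝ} (hc : Continuous h) (hm : Monotone h) (J : Set ℝ) :
    IsControl J fun s t => h t - h s where
  nonneg s _ t _ hst := sub_nonneg.mpr (hm hst)
  cont := by fun_prop
  diag s _ := sub_self _
  superadd s _ θ _ t _ _ _ := by linarith

/-- A continuous function of `s ≤ T ≤ t` that vanishes at `(T, T)` is dominated by any given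
positive power of a control. -/
theorem exists_control_of_continuousOn {N : ℝ × ℝ → ℝ} {T : ℝ} (hT : 0 ≤ T)
    (hN : ContinuousOn N (simplex (Ici 0))) (hN0 : N (T, T) = 0) {p : ℝ} (hp : 0 < p) :
    ∃ ω : ℝ → ℝ → ℝ, (∀ J, IsControl J ω) ∧
      ∀ s t, 0 ≤ s → s ≤ T → T ≤ t → N (s, t) ≤ ω s t ^ p := by
  -- New coordinates are the distances `T - s` and `t - T`, clamped so that `n` is continuous on the
  -- whole plane.
  set n : ℝ × ℝ → ℝ := fun q => N (max (T - max q.1 0) 0, T + max q.2 0) with hn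
  have hncont : Continuous n := by
    refine hN.comp_continuous (by fun_prop) fun q => ⟨mem_Ici.mpr (le_max_right _ _), ?_, ?_⟩
    · exact add_nonneg hT (le_max_right _ _)
    · have := le_max_right q.1 0
      have := le_max_right q.2 0
      exact max_le (by linarith) (by linarith)
  set K : Set (ℝ × ℝ) := Icc 0 1 ×ˢ Icc 0 1 with hKdef
  have hK : IsCompact K := isCompact_Icc.prod isCompact_Icc
  -- The running maximum of `n` over the square of side `ρ`. Scaling from a fixed compact square
  -- gives continuity in `ρ`.
  set G : ℝ → ℝ := fun ρ => sSup ((fun q : ℝ × ℝ => n (ρ * q.1, ρ * q.2)) '' K) with hG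
  have hGcont : Continuous G := hK.continuous_sSup (by fun_prop)
  have hKne : K.Nonempty := ⟨(0, 0), by simp [hKdef]⟩
  have hbdd : ∀ ρ, BddAbove ((fun q : ℝ × ℝ => n (ρ * q.1, ρ * q.2)) '' K) := fun ρ =>
    (hK.image (by fun_prop)).bddAbove
  have hGneg : ∀ ρ ≤ 0, G ρ = 0 := by
    intro ρ hρ
    have h1 : (fun q : ℝ × ℝ => n (ρ * q.1, ρ * q.2)) '' K = {0} := by
      refine (hKne.image _).subset_singleton_iff.mp ?_
      rintro _ ⟨q, hq, rfl⟩
      have h2 : ρ * q.1 ≤ 0 := mul_nonpos_of_nonpos_of_nonneg hρ hq.1.1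
      have h3 : ρ * q.2 ≤ 0 := mul_nonpos_of_nonpos_of_nonneg hρ hq.2.1
      simp [hn, max_eq_right h2, max_eq_right h3, max_eq_left hT, hN0]
    simp only [hG, h1, csSup_singleton]
  have hnG : ∀ ρ a b, 0 ≤ a → a ≤ ρ → 0 ≤ b → b ≤ ρ → n (a, b) ≤ G ρ := by
    intro ρ a b ha haρ hb hbρ
    rcases (ha.trans haρ).eq_or_lt with h0 | h0
    · have ha0 : a = 0 := by linarith
      have hb0 : b = 0 := by linarith
      subst ha0 hb0
      rw [← h0, hGneg 0 le_rfl]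
      simp [hn, max_eq_left hT, hN0]
    · refine le_csSup (hbdd ρ) ⟨(a / ρ, b / ρ), ⟨⟨by positivity, ?_⟩, ⟨by positivity, ?_⟩⟩, ?_⟩
      · exact (div_le_one h0).mpr haρ
      · exact (div_le_one h0).mpr hbρ
      · simp only [mul_div_cancel₀ _ h0.ne']
  have hG0 : ∀ ρ, 0 ≤ G ρ := by
    intro ρ
    rcases le_total ρ 0 with h | h
    · exact (hGneg ρ h).ge
    · have := hnG ρ 0 0 le_rfl h le_rfl h
      have h1 : n (0, 0) = 0 := by simp [hn, max_eq_left hT, hN0]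
      rwa [h1] at this
  have hGmono : Monotone G := by
    intro ρ ρ' hρ
    rcases le_total ρ 0 with h | h
    · rw [hGneg ρ h]
      exact hG0 ρ'
    · refine csSup_le (hKne.image _) ?_
      rintro _ ⟨q, hq, rfl⟩
      exact hnG ρ' _ _ (mul_nonneg h hq.1.1) ((mul_le_of_le_one_right h hq.1.2).trans hρ)
        (mul_nonneg h hq.2.1) ((mul_le_of_le_one_right h hq.2.2).trans hρ)
  have hp' : 0 < p⁻¹ := inv_pos.mpr hp
  set g : ℝ → ℝ := fun ρ => G ρ ^ p⁻¹ with hg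
  have hgcont : Continuous g := hGcont.rpow_const fun _ => Or.inr hp'.le
  have hgmono : Monotone g := fun ρ ρ' h => Real.rpow_le_rpow (hG0 ρ) (hGmono h) hp'.le
  have hgneg : ∀ ρ ≤ 0, g ρ = 0 := fun ρ h => by
    simp only [hg, hGneg ρ h, Real.zero_rpow hp'.ne']
  have hg0 : ∀ ρ, 0 ≤ g ρ := fun ρ => Real.rpow_nonneg (hG0 ρ) _
  have hgp : ∀ ρ, g ρ ^ p = G ρ := fun ρ => Real.rpow_inv_rpow (hG0 ρ) hp.ne'
  -- The control is the increment of one nondecreasing function. For `s ≤ T ≤ t` it equals `g (t -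
  -- T) + g (T - s)`, which is at least `g` of the larger distance.
  refine ⟨fun s t => (g (t - T) - g (T - t)) - (g (s - T) - g (T - s)), fun J =>
    isControl_increment (h := fun t => g (t - T) - g (T - t)) (by fun_prop) ?_ J, ?_⟩
  · intro s t hst
    have h1 := hgmono (show s - T ≤ t - T by linarith)
    have h2 := hgmono (show T - t ≤ T - s by linarith)
    simp only
    linarith
  · intro s t hs hsT htT
    have h1 : N (s, t) = n (T - s, t - T) := by
      simp only [hn]
      rw [max_eq_left (sub_nonneg.mpr hsT), max_eq_left (sub_nonneg.mpr htT), sub_sub_cancel,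
        max_eq_left hs, add_sub_cancel]
    simp only
    rw [h1, hgneg (T - t) (by linarith), hgneg (s - T) (by linarith)]
    refine (hnG (max (T - s) (t - T)) _ _ (by linarith) (le_max_left _ _) (by linarith)
      (le_max_right _ _)).trans ?_
    rw [← hgp]
    refine Real.rpow_le_rpow (hg0 _) ?_ hp.le
    rcases le_total (T - s) (t - T) with h | h
    · rw [max_eq_right h]
      linarith [hg0 (T - s)]
    · rw [max_eq_left h]
      linarith [hg0 (t - T)]

/-! ## Dual norms -/

theorem sobolevNorm_nonneg (β : ℝ) (φ : L2) : 0 ≤ sobolevNorm β φ := Real.sqrt_nonneg _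

section

variable {β : ℝ} {g g' : L2 → ℝ} {C C' : ℝ}

theorem DualBound.mono (h : DualBound β g C) (hC : C ≤ C') : DualBound β g C' := fun φ hφ =>
  (h φ hφ).trans (mul_le_mul_of_nonneg_right hC (sobolevNorm_nonneg β φ))

theorem DualBound.congr (h : DualBound β g C) (hg : ∀ φ ∈ Hs β, g' φ = g φ) :
    DualBound β g' C := fun φ hφ => by
  rw [hg φ hφ]
  exact h φ hφ

theorem DualBound.add (h : DualBound β g C) (h' : DualBound β g' C') :
    DualBound β (fun φ => g φ + g' φ) (C + C') := fun φ hφ => by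
  rw [add_mul]
  exact (abs_add_le _ _).trans (add_le_add (h φ hφ) (h' φ hφ))

theorem DualBound.sub (h : DualBound β g C) (h' : DualBound β g' C') :
    DualBound β (fun φ => g φ - g' φ) (C + C') := fun φ hφ => by
  rw [add_mul]
  exact (abs_sub _ _).trans (add_le_add (h φ hφ) (h' φ hφ))

theorem DualBound.eq_zero (h : DualBound β g 0) {φ : L2} (hφ : φ ∈ Hs β) : g φ = 0 := by
  have := h φ hφ
  rw [zero_mul] at this
  exact abs_nonpos_iff.mp this

theorem MemDual.congr (h : MemDual β g) (hg : ∀ φ ∈ Hs β, g' φ = g φ)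
    (hadd : ∀ φ ∈ Hs β, ∀ ψ ∈ Hs β, φ + ψ ∈ Hs β) (hsmul : ∀ (c : ℝ), ∀ φ ∈ Hs β, c • φ ∈ Hs β) :
    MemDual β g' where
  add φ hφ ψ hψ := by rw [hg _ (hadd φ hφ ψ hψ), hg φ hφ, hg ψ hψ, h.add φ hφ ψ hψ]
  smul c φ hφ := by rw [hg _ (hsmul c φ hφ), hg φ hφ, h.smul c φ hφ]
  bounded := h.bounded.imp fun _ hC => hC.congr hg

theorem MemDual.addFun (h : MemDual β g) (h' : MemDual β g') : MemDual β fun φ => g φ + g' φ where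
  add φ hφ ψ hψ := by
    rw [h.add φ hφ ψ hψ, h'.add φ hφ ψ hψ]
    ring
  smul c φ hφ := by
    rw [h.smul c φ hφ, h'.smul c φ hφ]
    ring
  bounded := by
    obtain ⟨C, hC⟩ := h.bounded
    obtain ⟨C', hC'⟩ := h'.bounded
    exact ⟨_, hC.add hC'⟩

theorem MemDual.subFun (h : MemDual β g) (h' : MemDual β g') : MemDual β fun φ => g φ - g' φ where
  add φ hφ ψ hψ := by
    rw [h.add φ hφ ψ hψ, h'.add φ hφ ψ hψ]
    ring
  smul c φ hφ := by
    rw [h.smul c φ hφ, h'.smul c φ hφ]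
    ring
  bounded := by
    obtain ⟨C, hC⟩ := h.bounded
    obtain ⟨C', hC'⟩ := h'.bounded
    exact ⟨_, hC.sub hC'⟩

/-- The norm of a functional in the dual of `H^β`. -/
def dualNorm (β : ℝ) (g : L2 → ℝ) : ℝ := sInf {C | 0 ≤ C ∧ DualBound β g C}

theorem dualNorm_nonneg (β : ℝ) (g : L2 → ℝ) : 0 ≤ dualNorm β g :=
  Real.sInf_nonneg fun _ hC => hC.1

theorem DualBound.dualNorm_le (h : DualBound β g C) (hC : 0 ≤ C) : dualNorm β g ≤ C :=
  csInf_le ⟨0, fun _ h => h.1⟩ ⟨hC, h⟩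

/-- The infimum of the admissible constants is itself admissible; where the Sobolev norm of `φ`
vanishes, any one constant already forces `g φ = 0`. -/
theorem MemDual.dualBound_dualNorm (h : MemDual β g) : DualBound β g (dualNorm β g) := by
  obtain ⟨C, hC⟩ := h.bounded
  have hne : {C | 0 ≤ C ∧ DualBound β g C}.Nonempty :=
    ⟨max C 0, le_max_right _ _, hC.mono (le_max_left _ _)⟩
  intro φ hφ
  rcases (sobolevNorm_nonneg β φ).eq_or_lt with h0 | h0
  · have := hC φ hφ
    rw [← h0, mul_zero] at this ⊢
    exact this
  · rw [← div_le_iff₀ h0]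
    exact le_csInf hne fun C' hC' => (div_le_iff₀ h0).mpr (hC'.2 φ hφ)

end

theorem Hs.add_mem {β : ℝ} {φ ψ : L2} (hφ : φ ∈ Hs β) (hψ : ψ ∈ Hs β) : φ + ψ ∈ Hs β := by
  refine ⟨H0.add_mem hφ.1 hψ.1, ?_⟩
  have hle : sobolevSq β (φ + ψ) ≤ ENNReal.ofReal 2 * (sobolevSq β φ + sobolevSq β ψ) := by
    unfold sobolevSq
    rw [← ENNReal.tsum_add, ← ENNReal.tsum_mul_left]
    refine ENNReal.tsum_le_tsum fun n => ?_
    rw [← ENNReal.ofReal_add (by positivity) (by positivity),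
      ← ENNReal.ofReal_mul (by norm_num)]
    refine ENNReal.ofReal_le_ofReal ?_
    rw [← mul_add, mul_left_comm, ← Finset.sum_add_distrib, Finset.mul_sum (a := (2 : ℝ))]
    gcongr with j
    rw [fc_add]
    have h1 := norm_add_le (fc φ n j) (fc ψ n j)
    have h2 := norm_nonneg (fc φ n j + fc ψ n j)
    nlinarith [sq_nonneg (‖fc φ n j‖ - ‖fc ψ n j‖)]
  exact ne_top_of_le_ne_top
    (ENNReal.mul_ne_top (by simp) (ENNReal.add_ne_top.mpr ⟨hφ.2, hψ.2⟩)) hle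

theorem Hs.smul_mem {β : ℝ} (c : ℝ) {φ : L2} (hφ : φ ∈ Hs β) : c • φ ∈ Hs β := by
  refine ⟨H0.smul_mem c hφ.1, ?_⟩
  have hle : sobolevSq β (c • φ) = ENNReal.ofReal (c ^ 2) * sobolevSq β φ := by
    unfold sobolevSq
    rw [← ENNReal.tsum_mul_left]
    refine tsum_congr fun n => ?_
    rw [← ENNReal.ofReal_mul (by positivity)]
    simp only [fc_smul, norm_mul, mul_pow, ← Finset.mul_sum, Complex.norm_real, Real.norm_eq_abs,
      sq_abs]
    congr 1
    ring
  rw [hle]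
  exact ENNReal.mul_ne_top ENNReal.ofReal_ne_top hφ.2

/-! ## Remainders of a concatenation -/

/-- Reverse triangle inequality for the dual norm. -/
theorem continuousOn_dualNorm {β : ℝ} {R : ℝ → ℝ → L2 → ℝ}
    (hmem : ∀ s t, 0 ≤ s → s ≤ t → MemDual β (R s t))
    (hcont : ∀ a ∈ simplex (Ici 0), ∀ ε > 0, ∀ᶠ b in 𝓝[simplex (Ici 0)] a,
      DualBound β (fun φ => R b.1 b.2 φ - R a.1 a.2 φ) ε) :
    ContinuousOn (fun q : ℝ × ℝ => dualNorm β (R q.1 q.2)) (simplex (Ici 0)) := by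
  intro a ha
  refine Metric.tendsto_nhds.mpr fun ε hε => ?_
  filter_upwards [hcont a ha (ε / 2) (half_pos hε), self_mem_nhdsWithin] with b hb hbs
  have hRa := (hmem a.1 a.2 ha.1 ha.2.2).dualBound_dualNorm
  have hRb := (hmem b.1 b.2 hbs.1 hbs.2.2).dualBound_dualNorm
  have h1 : dualNorm β (R b.1 b.2) ≤ ε / 2 + dualNorm β (R a.1 a.2) :=
    ((hb.add hRa).congr fun φ _ => by ring).dualNorm_le
      (add_nonneg (half_pos hε).le (dualNorm_nonneg _ _))
  have h2 : dualNorm β (R a.1 a.2) ≤ dualNorm β (R b.1 b.2) + ε / 2 :=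
    ((hRb.sub hb).congr fun φ _ => by ring).dualNorm_le
      (add_nonneg (dualNorm_nonneg _ _) (half_pos hε).le)
  rw [Real.dist_eq, abs_lt]
  constructor <;> linarith

/-- On the diagonal `ϖ` vanishes, so the variation bound is available there, and its right-hand side
is zero. -/
theorem MemVarLoc.diag_eq_zero {β q L : ℝ} {ϖ : ℝ → ℝ → ℝ} {R : ℝ → ℝ → L2 → ℝ} (hq : 0 < q)
    (h : MemVarLoc β q ϖ L R) (hϖ : IsControl (Ici 0) ϖ) (hL : 0 < L) {t : ℝ} (ht : 0 ≤ t) {φ : L2}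
    (hφ : φ ∈ Hs β) : R t t φ = 0 := by
  obtain ⟨ω, hω, hb⟩ := h.var (t + 1) (by linarith)
  have h1 := hb t t ht le_rfl (by linarith) (by rw [hϖ.diag t ht]; exact hL.le)
  rw [hω.diag t ⟨ht, by linarith⟩, Real.zero_rpow (by positivity)] at h1
  exact h1.eq_zero hφ

/-- Gluing of remainders at the time `T`. For `s ≤ T ≤ t` the terms with the driver cancel in
`R s t = R₁ s t - R₁ T t + R₂ 0 (t - T)`, and the part of `R` that crosses the time `T` is
dominated by a control because it is continuous in the dual norm and vanishes at `(T, T)`. -/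
theorem MemVarLoc.concat {β q T L₁ L₂ : ℝ} {ϖ₁ ϖ₂ : ℝ → ℝ → ℝ} {R₁ R₂ R : ℝ → ℝ → L2 → ℝ}
    (hq : 0 < q) (hT : 0 < T) (hϖ₁ : IsControl (Ici 0) ϖ₁) (hϖ₂ : IsControl (Ici 0) ϖ₂)
    (hL₁ : 0 < L₁) (hL₂ : 0 < L₂) (h₁ : MemVarLoc β q ϖ₁ L₁ R₁) (h₂ : MemVarLoc β q ϖ₂ L₂ R₂)
    (hleft : ∀ s t, 0 ≤ s → s ≤ t → t ≤ T → ∀ φ ∈ Hs β, R s t φ = R₁ s t φ)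
    (hright : ∀ s t, T ≤ s → s ≤ t → ∀ φ ∈ Hs β, R s t φ = R₂ (s - T) (t - T) φ)
    (hmid : ∀ s t, 0 ≤ s → s ≤ T → T ≤ t → ∀ φ ∈ Hs β,
      R s t φ = R₁ s t φ - R₁ T t φ + R₂ 0 (t - T) φ) :
    ∃ (ϖ : ℝ → ℝ → ℝ) (L : ℝ), IsControl (Ici 0) ϖ ∧ 0 < L ∧ MemVarLoc β q ϖ L R := by
  have z₁ : ∀ t, 0 ≤ t → ∀ φ ∈ Hs β, R₁ t t φ = 0 := fun t ht φ hφ =>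
    h₁.diag_eq_zero hq hϖ₁ hL₁ ht hφ
  have z₂ : ∀ t, 0 ≤ t → ∀ φ ∈ Hs β, R₂ t t φ = 0 := fun t ht φ hφ =>
    h₂.diag_eq_zero hq hϖ₂ hL₂ ht hφ
  -- One formula covers all positions of `s` and `t` relative to `T`, since superfluous terms become
  -- diagonal values, or cancel. Duality and continuity of `R` then follow from those of `R₁` and
  -- `R₂`.
  have hR : ∀ s t, 0 ≤ s → s ≤ t → ∀ φ ∈ Hs β, R s t φ =
      R₁ s t φ - R₁ (max s T) (max t T) φ + R₂ (max s T - T) (max t T - T) φ := by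
    intro s t hs hst φ hφ
    rcases le_total t T with ht | ht
    · rw [max_eq_right ht, max_eq_right (hst.trans ht), sub_self, z₁ T hT.le φ hφ,
        z₂ 0 le_rfl φ hφ, hleft s t hs hst ht φ hφ]
      ring
    · rcases le_total s T with hs' | hs'
      · rw [max_eq_left ht, max_eq_right hs', sub_self, hmid s t hs hs' ht φ hφ]
      · rw [max_eq_left ht, max_eq_left hs', hright s t hs' hst φ hφ]
        ring
  have hmem : ∀ s t, 0 ≤ s → s ≤ t → MemDual β (R s t) := by
    intro s t hs hst
    have m1 := h₁.mem s t hs hst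
    have m2 := h₁.mem (max s T) (max t T) (hs.trans (le_max_left _ _)) (max_le_max_right T hst)
    have m3 := h₂.mem (max s T - T) (max t T - T) (sub_nonneg.mpr (le_max_right _ _))
      (sub_le_sub_right (max_le_max_right T hst) T)
    exact ((m1.subFun m2).addFun m3).congr (hR s t hs hst) (fun _ hφ _ hψ => Hs.add_mem hφ hψ)
      fun c _ hφ => Hs.smul_mem c hφ
  have hcont : ∀ a ∈ simplex (Ici 0), ∀ ε > 0, ∀ᶠ b in 𝓝[simplex (Ici 0)] a,
      DualBound β (fun φ => R b.1 b.2 φ - R a.1 a.2 φ) ε := by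
    intro a ha ε hε
    have map : ∀ k : ℝ → ℝ, Continuous k → Monotone k → MapsTo k (Ici 0) (Ici 0) →
        Tendsto (fun b : ℝ × ℝ => (k b.1, k b.2)) (𝓝[simplex (Ici 0)] a)
          (𝓝[simplex (Ici 0)] (k a.1, k a.2)) := by
      intro k hk hm hmaps
      refine ContinuousWithinAt.tendsto_nhdsWithin (by fun_prop) fun b hb => ?_
      exact ⟨hmaps hb.1, hmaps hb.2.1, hm hb.2.2⟩
    have k1 : MapsTo (fun s => max s T) (Ici 0) (Ici 0) := fun s _ => hT.le.trans (le_max_right _ _)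
    have k2 : MapsTo (fun s => max s T - T) (Ici 0) (Ici 0) := fun s _ =>
      sub_nonneg.mpr (le_max_right s T)
    have n1 : Monotone fun s => max s T := fun _ _ h => max_le_max_right T h
    have n2 : Monotone fun s => max s T - T := fun _ _ h => sub_le_sub_right (n1 h) T
    have e1 := h₁.cont a ha (ε / 3) (by positivity)
    have e2 := (map _ (by fun_prop) n1 k1).eventually
      (h₁.cont (max a.1 T, max a.2 T) ⟨k1 ha.1, k1 ha.2.1, n1 ha.2.2⟩ (ε / 3) (by positivity))
    have e3 := (map _ (by fun_prop) n2 k2).eventually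
      (h₂.cont (max a.1 T - T, max a.2 T - T) ⟨k2 ha.1, k2 ha.2.1, n2 ha.2.2⟩ (ε / 3)
        (by positivity))
    filter_upwards [e1, e2, e3, self_mem_nhdsWithin] with b d1 d2 d3 hb
    refine (((d1.sub d2).add d3).mono (by linarith)).congr fun φ hφ => ?_
    rw [hR b.1 b.2 hb.1 hb.2.2 φ hφ, hR a.1 a.2 ha.1 ha.2.2 φ hφ]
    ring
  have hp : 0 < 1 / q := by positivity
  obtain ⟨ω₃, hω₃, hcross⟩ := exists_control_of_continuousOn hT.le
    (continuousOn_dualNorm hmem hcont)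
    (le_antisymm (DualBound.dualNorm_le (fun φ hφ => by
      simp [hleft T T hT.le le_rfl le_rfl φ hφ, z₁ T hT.le φ hφ]) le_rfl) (dualNorm_nonneg _ _)) hp
  have cmin : Continuous fun s => min s T := by fun_prop
  have cmax : Continuous fun s => max (s - T) 0 := by fun_prop
  have mmin : Monotone fun s => min s T := fun _ _ h => min_le_min_right T h
  have mmax : Monotone fun s => max (s - T) 0 := fun _ _ h =>
    max_le_max_right 0 (sub_le_sub_right h T)
  have jmin : MapsTo (fun s => min s T) (Ici 0) (Ici 0) := fun s hs => le_min hs hT.le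
  have jmax : MapsTo (fun s => max (s - T) 0) (Ici 0) (Ici 0) := fun s _ =>
    mem_Ici.mpr (le_max_right _ _)
  have c₁ := hϖ₁.comp cmin mmin jmin
  have c₂ := hϖ₂.comp cmax mmax jmax
  -- Smallness of the summed truncated controls below `min L₁ L₂` implies each local smallness
  -- condition on its own side of `T`.
  refine ⟨_, min L₁ L₂, c₁.add c₂, lt_min hL₁ hL₂, hmem, hcont, fun τ hτ => ?_⟩
  obtain ⟨ω₁, hω₁, hb₁⟩ := h₁.var τ hτ
  obtain ⟨ω₂, hω₂, hb₂⟩ := h₂.var τ hτ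
  have imin : MapsTo (fun s => min s T) (Icc 0 τ) (Icc 0 τ) := fun s hs =>
    ⟨le_min hs.1 hT.le, (min_le_left _ _).trans hs.2⟩
  have imax : MapsTo (fun s => max (s - T) 0) (Icc 0 τ) (Icc 0 τ) := fun s hs =>
    ⟨le_max_right _ _, max_le (by linarith [hs.2]) hτ.le⟩
  have d₁ := hω₁.comp cmin mmin imin
  have d₂ := hω₂.comp cmax mmax imax
  refine ⟨_, (d₁.add d₂).add (hω₃ _), fun s t hs hst htτ hϖ => ?_⟩
  have hsJ : s ∈ Icc 0 τ := ⟨hs, hst.trans htτ⟩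
  have htJ : t ∈ Icc 0 τ := ⟨hs.trans hst, htτ⟩
  have p₁ := d₁.nonneg s hsJ t htJ hst
  have p₂ := d₂.nonneg s hsJ t htJ hst
  have p₃ := (hω₃ (Icc 0 τ)).nonneg s hsJ t htJ hst
  have q₁ := c₁.nonneg s hs t (hs.trans hst) hst
  have q₂ := c₂.nonneg s hs t (hs.trans hst) hst
  have l₁ := hϖ.trans (min_le_left L₁ L₂)
  have l₂ := hϖ.trans (min_le_right L₁ L₂)
  rcases le_total t T with ht | ht
  · have hs' := hst.trans ht
    simp only [min_eq_left ht, min_eq_left hs'] at *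
    refine ((hb₁ s t hs hst htτ (by linarith)).congr (hleft s t hs hst ht)).mono ?_
    exact Real.rpow_le_rpow p₁ (by linarith) hp.le
  rcases le_total s T with hs' | hs'
  -- Straddling intervals are governed by `ω₃` alone, with no smallness condition.
  · refine (hmem s t hs hst).dualBound_dualNorm.mono ((hcross s t hs hs' ht).trans ?_)
    exact Real.rpow_le_rpow p₃ (by linarith) hp.le
  · simp only [max_eq_left (sub_nonneg.mpr ht), max_eq_left (sub_nonneg.mpr hs')] at *
    refine ((hb₂ (s - T) (t - T) (by linarith) (by linarith) (by linarith) (by linarith)).congr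
      (hright s t hs' hst)).mono ?_
    exact Real.rpow_le_rpow p₂ (by linarith) hp.le


/-! ### Concatenated velocities and the shifted driver -/

theorem concat_of_le {X : Type*} {T : ℝ} {w₁ w₂ : ℝ → X} {t : ℝ} (h : t ≤ T) :
    concat T w₁ w₂ t = w₁ t := if_pos h

theorem concat_of_ge {X : Type*} {T : ℝ} {w₁ w₂ : ℝ → X} (h0 : w₂ 0 = w₁ T) {t : ℝ} (h : T ≤ t) :
    concat T w₁ w₂ t = w₂ (t - T) := by
  rcases h.eq_or_lt with rfl | h
  · rw [concat_of_le le_rfl, sub_self, h0]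
  · exact if_neg h.not_ge

theorem A1star_shift {K : ℕ} (σ : Fin K → T3 → E3) (Z : TwoLevel K) (T s t : ℝ) (φ : L2) :
    A1star σ (Z.shift T) (s - T) (t - T) φ = A1star σ Z s t φ := by
  unfold A1star
  congr 1
  funext ψ
  simp [A1, TwoLevel.shift]

theorem A2star_shift {K : ℕ} (σ : Fin K → T3 → E3) (Z : TwoLevel K) (T s t : ℝ) (φ : L2) :
    A2star σ (Z.shift T) (s - T) (t - T) φ = A2star σ Z s t φ := by
  unfold A2star
  congr 1
  funext ψ
  simp [A2, TwoLevel.shift]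

section

variable {K : ℕ} {σ : Fin K → T3 → E3} {Z : TwoLevel K} {T : ℝ} {u u' : ℝ → L2}

theorem remainder_concat_left {s t : ℝ} (hst : s ≤ t) (ht : t ≤ T) (φ : L2) :
    remainder σ Z (concat T u u') s t φ = remainder σ Z u s t φ := by
  unfold remainder
  have hi : ∫ r in s..t, (gradInner (concat T u u' r) φ + BP (concat T u u' r) φ) =
      ∫ r in s..t, (gradInner (u r) φ + BP (u r) φ) := by
    refine intervalIntegral.integral_congr fun r hr => ?_
    rw [uIcc_of_le hst] at hr
    simp only [concat_of_le (hr.2.trans ht)]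
  rw [hi, concat_of_le ht, concat_of_le (hst.trans ht)]

theorem integral_drift_concat_right (h0 : u' 0 = u T) {s t : ℝ} (hs : T ≤ s) (hst : s ≤ t) (φ : L2) :
    ∫ r in s..t, (gradInner (concat T u u' r) φ + BP (concat T u u' r) φ) =
      ∫ r in (s - T)..(t - T), (gradInner (u' r) φ + BP (u' r) φ) := by
  rw [← intervalIntegral.integral_comp_sub_right]
  refine intervalIntegral.integral_congr fun r hr => ?_
  rw [uIcc_of_le hst] at hr
  simp only [concat_of_ge h0 (hs.trans hr.1)]

theorem remainder_concat_right (h0 : u' 0 = u T) {s t : ℝ} (hs : T ≤ s) (hst : s ≤ t) (φ : L2) :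
    remainder σ Z (concat T u u') s t φ = remainder σ (Z.shift T) u' (s - T) (t - T) φ := by
  unfold remainder
  rw [integral_drift_concat_right h0 hs hst, concat_of_ge h0 hs, concat_of_ge h0 (hs.trans hst),
    A1star_shift, A2star_shift]

/-- In the difference of the first two remainders the value `u t` beyond `T` and the drift on `[T,
t]` drop out; what remains at time `T`, including the driver term over `[T, t]`, cancels against the
third. Integrability allows both drift integrals to be cut at `T`. -/
theorem remainder_concat_mid (h0 : u' 0 = u T) {s t : ℝ} (hs : s ≤ T) (ht : T ≤ t) {φ : L2}
    (hint : IntervalIntegrable (fun r => gradInner (u r) φ + BP (u r) φ) volume s t)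
    (hint' : IntervalIntegrable
      (fun r => gradInner (concat T u u' r) φ + BP (concat T u u' r) φ) volume s t) :
    remainder σ Z (concat T u u') s t φ =
      remainder σ Z u s t φ - remainder σ Z u T t φ + remainder σ (Z.shift T) u' 0 (t - T) φ := by
  have hsT : uIcc s T ⊆ uIcc s t := by
    rw [uIcc_of_le hs, uIcc_of_le (hs.trans ht)]
    exact Icc_subset_Icc_right ht
  have hTt : uIcc T t ⊆ uIcc s t := by
    rw [uIcc_of_le ht, uIcc_of_le (hs.trans ht)]
    exact Icc_subset_Icc_left hs
  have e1 := intervalIntegral.integral_add_adjacent_intervals (hint.mono_set hsT)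
    (hint.mono_set hTt)
  have e2 := intervalIntegral.integral_add_adjacent_intervals (hint'.mono_set hsT)
    (hint'.mono_set hTt)
  have e3 := integral_drift_concat_right h0 le_rfl ht φ
  have e4 : ∫ r in s..T, (gradInner (concat T u u' r) φ + BP (concat T u u' r) φ) =
      ∫ r in s..T, (gradInner (u r) φ + BP (u r) φ) := by
    refine intervalIntegral.integral_congr fun r hr => ?_
    rw [uIcc_of_le hs] at hr
    simp only [concat_of_le hr.2]
  rw [sub_self] at e3
  have a1 := A1star_shift σ Z T T t φ
  have a2 := A2star_shift σ Z T T t φ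
  rw [sub_self] at a1 a2
  unfold remainder
  rw [← e1, ← e2, e3, e4, a1, a2, concat_of_ge h0 ht, concat_of_le hs, h0]
  simp only [inner_sub_left]
  ring

end

/-! ## Concatenation of weak solutions -/

theorem continuousOn_concat {X : Type*} [TopologicalSpace X] {T : ℝ} (hT : 0 ≤ T) {w₁ w₂ : ℝ → X}
    (h₁ : ContinuousOn w₁ (Ici 0)) (h₂ : ContinuousOn w₂ (Ici 0)) (h0 : w₂ 0 = w₁ T) :
    ContinuousOn (concat T w₁ w₂) (Ici 0) := by
  have c1 : ContinuousOn (concat T w₁ w₂) (Icc 0 T) :=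
    (h₁.mono Icc_subset_Ici_self).congr fun t ht => concat_of_le ht.2
  have c2 : ContinuousOn (concat T w₁ w₂) (Ici T) :=
    (h₂.comp (f := fun t => t - T) (s := Ici T) (by fun_prop)
      fun _ ht => mem_Ici.mpr (sub_nonneg.mpr ht)).congr fun _ ht => concat_of_ge h0 ht
  rw [← Icc_union_Ici_eq_Ici hT]
  exact c1.union_of_isClosed c2 isClosed_Icc isClosed_Ici

theorem measurePreserving_sub_Icc (T τ : ℝ) : MeasurePreserving (fun t => t - T)
    (volume.restrict (Icc T (T + τ))) (volume.restrict (Icc 0 τ)) := by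
  have h := (measurePreserving_sub_right (volume : Measure ℝ) T).restrict_preimage
    (measurableSet_Icc (a := (0 : ℝ)) (b := τ))
  have h2 : (fun t : ℝ => t - T) ⁻¹' Icc 0 τ = Icc T (T + τ) := by
    rw [preimage_sub_const_Icc, zero_add, add_comm]
  rwa [h2] at h

theorem measurePreserving_sub_Ici (T : ℝ) : MeasurePreserving (fun t => t - T)
    (volume.restrict (Ici T)) (volume.restrict (Ici 0)) := by
  have h := (measurePreserving_sub_right (volume : Measure ℝ) T).restrict_preimage
    (measurableSet_Ici (a := (0 : ℝ)))
  have h2 : (fun t : ℝ => t - T) ⁻¹' Ici 0 = Ici T := by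
    rw [preimage_sub_const_Ici, zero_add]
  rwa [h2] at h

/-- The single time `T` is null, so the two conventions for the energy at `T` are interchangeable.
-/
theorem ae_restrict_Ici_of_split {T : ℝ} {p : ℝ → Prop}
    (h₁ : ∀ᵐ t ∂(volume.restrict (Ici 0)), t < T → p t)
    (h₂ : ∀ᵐ t ∂(volume.restrict (Ici T)), T < t → p t) :
    ∀ᵐ t ∂(volume.restrict (Ici 0)), p t := by
  rw [ae_restrict_iff' measurableSet_Ici] at *
  filter_upwards [h₁, h₂, Measure.ae_ne volume T] with t ht1 ht2 hne ht
  rcases lt_or_gt_of_ne hne with h | h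
  · exact ht1 ht h
  · exact ht2 h.le h

theorem IsWeakSolution.concat {K : ℕ} {σ : Fin K → T3 → E3} {α : ℝ} (hα : 0 < α) {Z : TwoLevel K}
    {u₀ : L2} {E₀ T : ℝ} (hT : 0 < T) {u u' : ℝ → L2} {E₁ E₂ : ℝ → ℝ} {e : ℝ}
    (h : IsWeakSolution σ α Z u₀ E₀ u E₁) (h' : IsWeakSolution σ α (Z.shift T) (u T) e u' E₂)
    (he : e ≤ lim_left E₁ T) :
    IsWeakSolution σ α Z u₀ E₀ (RoughNS.concat T u u') (concatEnergy T E₁ E₂) := by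
  have h0 : u' 0 = u T := h'.u_init
  have he' : E₂ 0 ≤ lim_left E₁ T := by rwa [h'.E_init]
  have hw : ∀ v : L2, ContinuousOn (fun t => (inner ℝ (RoughNS.concat T u u' t) v : ℝ)) (Ici 0) := by
    intro v
    refine (continuousOn_concat hT.le (h.u_weak_cont v) (h'.u_weak_cont v) (by rw [h0])).congr
      fun t _ => ?_
    unfold RoughNS.concat
    split_ifs <;> rfl
  have hcover : ∀ τ, 0 < τ → Icc 0 τ ⊆ Icc 0 T ∪ Icc T (T + τ) := by
    intro τ _ t ht
    rcases le_total t T with hle | hle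
    · exact Or.inl ⟨ht.1, hle⟩
    · exact Or.inr ⟨hle, by linarith [ht.2]⟩
  have hS : ∀ τ, 0 < τ → ∫⁻ t in Icc 0 τ, sobolevSq 1 (RoughNS.concat T u u' t) < ∞ := by
    intro τ hτ
    refine (lintegral_mono_set (hcover τ hτ)).trans_lt ((lintegral_union_le _ _ _).trans_lt
      (ENNReal.add_lt_top.mpr ⟨?_, ?_⟩))
    · rw [setLIntegral_congr_fun (g := fun t => sobolevSq 1 (u t)) measurableSet_Icc fun t ht => by
        simp only [concat_of_le ht.2]]
      exact h.u_L2H1 T hT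
    · rw [setLIntegral_congr_fun (g := fun t => sobolevSq 1 (u' (t - T))) measurableSet_Icc
        fun t ht => by simp only [concat_of_ge h0 ht.1]]
      rw [(measurePreserving_sub_Icc T τ).lintegral_comp_emb
        (MeasurableEquiv.subRight T).measurableEmbedding (fun t => sobolevSq 1 (u' t))]
      exact h'.u_L2H1 τ hτ
  have hint : ∀ {v : ℝ → L2},
      (∀ f : L2, ContinuousOn (fun t => (inner ℝ (v t) f : ℝ)) (Ici 0)) →
      (∀ τ, 0 < τ → ∫⁻ t in Icc 0 τ, sobolevSq 1 (v t) < ∞) → ∀ {φ : L2}, φ ∈ Hs 3 →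
      ∀ s t, 0 ≤ s → s ≤ t →
      IntervalIntegrable (fun r => gradInner (v r) φ + BP (v r) φ) volume s t := by
    intro v hv hvS φ hφ s t hs hst
    rw [intervalIntegrable_iff_integrableOn_Icc_of_le hst]
    exact (integrableOn_drift hv (hvS (t + 1) (by linarith)) hφ).mono_set
      (Icc_subset_Icc hs (by linarith))
  refine
    { data_mem := h.data_mem
      data_le := h.data_le
      u_mem := ?_
      u_weak_cont := hw
      u_L2H1 := hS
      u_bounded := ?_
      u_init := (concat_of_le hT.le).trans h.u_init
      E_nonneg := ?_
      E_eq := ?_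
      E_init := (concatEnergy_of_lt hT).trans h.E_init
      E_antitone := antitoneOn_concatEnergy h.E_antitone h'.E_antitone he'
      energy := ?_
      remainder_mem := ?_ }
  · intro t ht
    rcases le_total t T with hle | hle
    · rw [concat_of_le hle]
      exact h.u_mem t ht
    · rw [concat_of_ge h0 hle]
      exact h'.u_mem _ (sub_nonneg.mpr hle)
  · intro τ hτ
    obtain ⟨C, hC⟩ := h.u_bounded T hT
    obtain ⟨C', hC'⟩ := h'.u_bounded τ hτ
    refine ⟨max C C', ae_restrict_of_ae_restrict_of_subset (hcover τ hτ) ?_⟩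
    rw [ae_restrict_union_iff]
    constructor
    · filter_upwards [hC, ae_restrict_mem measurableSet_Icc] with t h1 h2
      rw [concat_of_le h2.2]
      exact h1.trans (le_max_left _ _)
    · filter_upwards [(measurePreserving_sub_Icc T τ).quasiMeasurePreserving.ae hC',
        ae_restrict_mem measurableSet_Icc] with t h1 h2
      rw [concat_of_ge h0 h2.1]
      exact h1.trans (le_max_right _ _)
  · intro t ht
    rcases lt_or_ge t T with hlt | hle
    · rw [concatEnergy_of_lt hlt]
      exact h.E_nonneg t ht
    · rw [concatEnergy_of_le hle]
      exact h'.E_nonneg _ (sub_nonneg.mpr hle)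
  · refine ae_restrict_Ici_of_split (T := T) ?_ ?_
    · filter_upwards [h.E_eq] with t ht hlt
      rw [concatEnergy_of_lt hlt, concat_of_le hlt.le, ht]
    · filter_upwards [(measurePreserving_sub_Ici T).quasiMeasurePreserving.ae h'.E_eq] with t ht hlt
      rw [concatEnergy_of_le hlt.le, concat_of_ge h0 hlt.le, ht]
  · exact EnergyInequality.concat (G₁ := fun t => gradInner (u t) (u t))
      (G₂ := fun t => gradInner (u' t) (u' t)) hT h.energy h'.energy h.E_antitone h'.E_antitone he'
      (fun τ hτ => integrableOn_gradInner_self h.u_weak_cont (h.u_L2H1 τ hτ))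
      (fun τ hτ => integrableOn_gradInner_self hw (hS τ hτ))
      (fun t ht => by rw [concat_of_le ht]) fun t ht => by rw [concat_of_ge h0 ht]
  · obtain ⟨ϖ₁, L₁, hϖ₁, hL₁, hR₁⟩ := h.remainder_mem
    obtain ⟨ϖ₂, L₂, hϖ₂, hL₂, hR₂⟩ := h'.remainder_mem
    refine hR₁.concat (by positivity) hT hϖ₁ hϖ₂ hL₁ hL₂ hR₂ ?_ ?_ ?_
    · exact fun s t _ hst ht φ _ => remainder_concat_left hst ht φ
    · exact fun s t hs hst φ _ => remainder_concat_right h0 hs hst φ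
    · exact fun s t hs hsT htT φ hφ => remainder_concat_mid h0 hsT htT
        (hint h.u_weak_cont h.u_L2H1 hφ s t hs (hsT.trans htT))
        (hint hw hS hφ s t hs (hsT.trans htT))

end RoughNS

end

theorem lemma3p3 {K : ℕ} (σ : Fin K → RoughNS.T3 → RoughNS.E3)
    (hσ : ∀ k, RoughNS.IsNoiseField (σ k))
    (α : ℝ) (hα : α ∈ Set.Ioc (1 / 3 : ℝ) (1 / 2))
    (Z : RoughNS.TwoLevel K) (hZ : RoughNS.IsRoughPath α Z)
    (u₀ : RoughNS.L2) (E₀ : ℝ) (T : ℝ) (hT : 0 < T)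
    (u u' : ℝ → RoughNS.L2) (E E' : ℝ → ℝ)
    (hu : (u, E) ∈ RoughNS.solutionSet σ α Z u₀ E₀)
    (e l : ℝ) (hl : RoughNS.IsEssLeftLim E T l) (he : e ≤ l)
    (hu' : (u', E') ∈ RoughNS.solutionSet σ α (Z.shift T) (u T) e) :
    (RoughNS.concat T u u', RoughNS.concat T E E') ∈ RoughNS.solutionSet σ α Z u₀ E₀ := by
  obtain ⟨E₁, hE₁, h⟩ := hu
  obtain ⟨E₂, hE₂, h'⟩ := hu'
  have hα0 : 0 < α := lt_trans (by norm_num) hα.1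
  -- The admissible representative is glued from the good representatives of the two energies. The
  -- bound on `e` transfers since `l` is the true left limit of `E₁` at `T`.
  refine ⟨RoughNS.concatEnergy T E₁ E₂, ?_, h.concat hα0 hT h'
    (he.trans_eq (hl.eq_lim_left hT h.E_antitone hE₁))⟩
  refine RoughNS.ae_restrict_Ici_of_split (T := T) ?_ ?_
  · filter_upwards [hE₁] with t ht hlt
    rw [RoughNS.concatEnergy_of_lt hlt, ht]
    exact (RoughNS.concat_of_le hlt.le).symm
  · filter_upwards [(RoughNS.measurePreserving_sub_Ici T).quasiMeasurePreserving.ae hE₂] with t ht hlt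
    rw [RoughNS.concatEnergy_of_le hlt.le, ht]
    exact (if_neg hlt.not_ge).symm
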